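/- Let $M$ be a connected complete $C^\infty$ Riemannian manifold (without boundary) of dimension two. Call a function $f : M \to \mathbb{R}$ of class $C^2$ a \emph{metric function} if the length $|\operatorname{grad} f|$ of its gradient is constant on each connected component of each level set of $f$. Let $f$ be a metric function on $M$ without critical points (that is, $df_x \neq 0$ for every $x \in M$). Call the nonempty level sets $\{p \in M : f(p) = c\}$, with the subspace topology, the level lines of $f$. Then either every level line of $f$ is homeomorphic to a circle, or every level line of $f$ is homeomorphic to the real line $\mathbb{R}$. -/

import Mathlib

open scoped Manifold ContDiff Bundle

noncomputable section

namespace MetricFunction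

section

variable {E : Type*} [NormedAddCommGroup E] [NormedSpace ℝ E] [FiniteDimensional ℝ E]
  {H : Type*} [TopologicalSpace H] (I : ModelWithCorners ℝ E H)
  {M : Type*} [TopologicalSpace M] [ChartedSpace H M]
  [Bundle.RiemannianBundle (fun x : M ↦ TangentSpace I x)]

instance finiteDimensional_tangentSpace (x : M) : FiniteDimensional ℝ (TangentSpace I x) :=
  inferInstanceAs (FiniteDimensional ℝ E)

instance completeSpace_tangentSpace (x : M) : CompleteSpace (TangentSpace I x) :=
  FiniteDimensional.complete ℝ (TangentSpace I x)

/-- The differential of a real function `f` at `x`, as a linear form on the tangent space. -/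
def differential (f : M → ℝ) (x : M) : StrongDual ℝ (TangentSpace I x) :=
  mfderiv I 𝓘(ℝ, ℝ) f x

/-- The Riemannian gradient of a real function `f` at `x`: the tangent vector at `x` that
represents the differential of `f` through the inner product of the tangent space. -/
def grad (f : M → ℝ) (x : M) : TangentSpace I x :=
  (InnerProductSpace.toDual ℝ (TangentSpace I x)).symm (differential I f x)

theorem inner_grad (f : M → ℝ) (x : M) (v : TangentSpace I x) :
    inner ℝ (grad I f x) v = differential I f x v :=
  InnerProductSpace.toDual_symm_apply

/-- A metric function: a real function of class `C^2` on a Riemannian manifold whose gradient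
has constant length on every connected component of every level set. -/
structure IsMetricFunction (f : M → ℝ) : Prop where
  contMDiff : ContMDiff I 𝓘(ℝ, ℝ) 2 f
  norm_grad_eq : ∀ x y : M, y ∈ connectedComponentIn (f ⁻¹' {f x}) x →
    ‖grad I f y‖ = ‖grad I f x‖

/-- A critical point of `f` is a point at which the differential of `f` vanishes. -/
def IsCriticalPoint (f : M → ℝ) (x : M) : Prop :=
  differential I f x = 0

end

/-- The level lines of `f` are its nonempty level sets `{p | f p = c}`. -/
def levelLines {M : Type*} (f : M → ℝ) : Set (Set M) :=
  {L | ∃ c ∈ Set.range f, L = {p | f p = c}}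

end MetricFunction

end

noncomputable section

namespace MetricFunction

open Bundle Module Filter Topology

section GramFormula

variable {V : Type*} [NormedAddCommGroup V] [InnerProductSpace ℝ V]

theorem gram_det_ne_zero (s : Basis (Fin 2) ℝ V) :
    inner ℝ (s 0) (s 0) * inner ℝ (s 1) (s 1) - inner ℝ (s 0) (s 1) * inner ℝ (s 0) (s 1) ≠ 0 := by
  intro h
  set c : ℝ := inner ℝ (s 1) (s 1) with hc
  set b : ℝ := inner ℝ (s 0) (s 1) with hb
  have hc0 : c ≠ 0 := by
    rw [hc, Ne, inner_self_eq_zero]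
    exact s.ne_zero 1
  have hw : c • s 0 - b • s 1 = 0 := by
    rw [← inner_self_eq_zero (𝕜 := ℝ)]
    simp only [inner_sub_left, inner_sub_right, inner_smul_left, inner_smul_right,
      real_inner_comm (s 0) (s 1), ← hb, ← hc]
    simp only [conj_trivial]
    linear_combination c * h
  have := congrArg (fun v => s.repr v 0) hw
  simp at this
  exact hc0 this

theorem gram_smul_eq (s : Basis (Fin 2) ℝ V) (v : V) :
    v = ((inner ℝ (s 0) (s 0) * inner ℝ (s 1) (s 1) - inner ℝ (s 0) (s 1) * inner ℝ (s 0) (s 1))⁻¹ *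
        (inner ℝ (s 1) (s 1) * inner ℝ v (s 0) - inner ℝ (s 0) (s 1) * inner ℝ v (s 1))) • s 0 +
      ((inner ℝ (s 0) (s 0) * inner ℝ (s 1) (s 1) - inner ℝ (s 0) (s 1) * inner ℝ (s 0) (s 1))⁻¹ *
        (inner ℝ (s 0) (s 0) * inner ℝ v (s 1) - inner ℝ (s 0) (s 1) * inner ℝ v (s 0))) • s 1 := by
  have h := gram_det_ne_zero s
  obtain ⟨x, y, rfl⟩ : ∃ x y : ℝ, v = x • s 0 + y • s 1 :=
    ⟨s.repr v 0, s.repr v 1, by conv_lhs => rw [← s.sum_repr v, Fin.sum_univ_two]⟩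
  simp only [inner_add_left, inner_smul_left, conj_trivial, real_inner_comm (s 0) (s 1)]
  congr 2
  · rw [eq_inv_mul_iff_mul_eq₀ h]
    ring
  · rw [eq_inv_mul_iff_mul_eq₀ h]
    ring

end GramFormula

variable {H : Type*} [TopologicalSpace H] {I : ModelWithCorners ℝ (EuclideanSpace ℝ (Fin 2)) H}
  {M : Type*} [TopologicalSpace M] [ChartedSpace H M]

section

variable [RiemannianBundle (fun x : M ↦ TangentSpace I x)]

/-- The gradient of `f` scaled to unit length. -/
def unitGrad (I : ModelWithCorners ℝ (EuclideanSpace ℝ (Fin 2)) H) {M : Type*} [TopologicalSpace M]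
    [ChartedSpace H M] [RiemannianBundle (fun x : M ↦ TangentSpace I x)] (f : M → ℝ) (x : M) :
    TangentSpace I x :=
  ‖grad I f x‖⁻¹ • grad I f x

theorem norm_grad_pos {f : M → ℝ} {x : M} (h : ¬ IsCriticalPoint I f x) : 0 < ‖grad I f x‖ := by
  rw [norm_pos_iff]
  intro h0
  apply h
  ext v
  rw [← inner_grad, h0, inner_zero_left]
  rfl

theorem norm_unitGrad {f : M → ℝ} {x : M} (h : ¬ IsCriticalPoint I f x) : ‖unitGrad I f x‖ = 1 := by
  rw [unitGrad, norm_smul, norm_inv, norm_norm, inv_mul_cancel₀ (norm_grad_pos h).ne']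

theorem differential_unitGrad {f : M → ℝ} {x : M} (h : ¬ IsCriticalPoint I f x) :
    differential I f x (unitGrad I f x) = ‖grad I f x‖ := by
  have := (norm_grad_pos h).ne'
  rw [← inner_grad, unitGrad, inner_smul_right, real_inner_self_eq_norm_sq]
  field_simp

end

variable [IsManifold I ∞ M]

theorem contMDiffAt_mfderiv_section {f : M → ℝ} (hf : ContMDiff I 𝓘(ℝ, ℝ) 2 f)
    {s : ∀ x : M, TangentSpace I x} {p : M}
    (hs : ContMDiffAt I I.tangent 1 (fun x => (⟨x, s x⟩ : TangentBundle I M)) p) :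
    ContMDiffAt I 𝓘(ℝ, ℝ) 1 (fun x => (mfderiv I 𝓘(ℝ, ℝ) f x (s x) : ℝ)) p := by
  have : IsManifold I 2 M := IsManifold.of_le (n := ∞) (by norm_cast)
  have h := (hf.contMDiff_tangentMap (m := 1) (by norm_num)).contMDiffAt.comp p hs
  have h2 := (contMDiffAt_totalSpace (IB := 𝓘(ℝ, ℝ)) (F := ℝ) (E := (TangentSpace 𝓘(ℝ, ℝ) : ℝ → Type _))).1 h
  simpa [tangentMap, Function.comp_def] using h2.2

variable [RiemannianBundle (fun x : M ↦ TangentSpace I x)]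
  [IsContMDiffRiemannianBundle I ∞ (EuclideanSpace ℝ (Fin 2)) (fun x : M ↦ TangentSpace I x)]

theorem contMDiff_grad {f : M → ℝ} (hf : ContMDiff I 𝓘(ℝ, ℝ) 2 f) :
    ContMDiff I I.tangent 1 (fun x => (⟨x, grad I f x⟩ : TangentBundle I M)) := by
  have : IsContMDiffRiemannianBundle I 1 (EuclideanSpace ℝ (Fin 2))
    (fun x : M ↦ TangentSpace I x) := .of_le (n := ∞) (by norm_cast)
  intro p
  let e := trivializationAt (EuclideanSpace ℝ (Fin 2)) (TangentSpace I : M → Type _) p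
  let b := (EuclideanSpace.basisFun (Fin 2) ℝ).toBasis
  let s : Fin 2 → ∀ x : M, TangentSpace I x := e.localFrame b
  have hp : p ∈ e.baseSet := FiberBundle.mem_baseSet_trivializationAt' p
  have hs : ∀ i, ContMDiffAt I I.tangent 1 (fun x => (⟨x, s i x⟩ : TangentBundle I M)) p :=
    fun i => contMDiffAt_localFrame_of_mem 1 e b i hp
  have hin : ∀ i j, ContMDiffAt I 𝓘(ℝ, ℝ) 1 (fun x => (inner ℝ (s i x) (s j x) : ℝ)) p :=
    fun i j => (hs i).inner_bundle (hs j)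
  have hd : ∀ i, ContMDiffAt I 𝓘(ℝ, ℝ) 1 (fun x => (inner ℝ (grad I f x) (s i x) : ℝ)) p := by
    intro i
    simp only [inner_grad]
    exact contMDiffAt_mfderiv_section hf (hs i)
  have hB : ∀ x ∈ e.baseSet, ∃ B : Basis (Fin 2) ℝ (TangentSpace I x), ∀ i, B i = s i x :=
    fun x hx => ⟨e.basisAt b hx, fun i => (e.localFrame_apply_of_mem_baseSet b hx).symm⟩
  have hdet : ContMDiffAt I 𝓘(ℝ, ℝ) 1 (fun x => (inner ℝ (s 0 x) (s 0 x) * inner ℝ (s 1 x) (s 1 x) -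
      inner ℝ (s 0 x) (s 1 x) * inner ℝ (s 0 x) (s 1 x) : ℝ)⁻¹) p := by
    refine ContMDiffAt.inv₀ (((hin 0 0).mul (hin 1 1)).sub ((hin 0 1).mul (hin 0 1))) ?_
    obtain ⟨B, hB⟩ := hB p hp
    have := gram_det_ne_zero B
    rwa [hB, hB] at this
  have key := ((hdet.mul (((hin 1 1).mul (hd 0)).sub ((hin 0 1).mul (hd 1)))).smul_section
    (hs 0)).add_section
    ((hdet.mul (((hin 0 0).mul (hd 1)).sub ((hin 0 1).mul (hd 0)))).smul_section (hs 1))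
  refine key.congr_of_eventuallyEq ?_
  filter_upwards [e.open_baseSet.mem_nhds hp] with x hx
  obtain ⟨B, hB⟩ := hB x hx
  have := gram_smul_eq B (grad I f x)
  rw [hB, hB] at this
  exact congrArg (TotalSpace.mk x) this

theorem contMDiff_norm_grad {f : M → ℝ} (hf : ContMDiff I 𝓘(ℝ, ℝ) 2 f)
    (hcrit : ∀ x : M, ¬ IsCriticalPoint I f x) :
    ContMDiff I 𝓘(ℝ, ℝ) 1 (fun x => ‖grad I f x‖) := by
  have : IsContMDiffRiemannianBundle I 1 (EuclideanSpace ℝ (Fin 2))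
    (fun x : M ↦ TangentSpace I x) := .of_le (n := ∞) (by norm_cast)
  intro p
  have h : ContMDiffAt I 𝓘(ℝ, ℝ) 1 (fun x => (inner ℝ (grad I f x) (grad I f x) : ℝ)) p :=
    (contMDiff_grad hf p).inner_bundle (contMDiff_grad hf p)
  have hne : (inner ℝ (grad I f p) (grad I f p) : ℝ) ≠ 0 := by
    rw [real_inner_self_eq_norm_sq]
    exact pow_ne_zero _ (norm_grad_pos (hcrit p)).ne'
  have := (Real.contDiffAt_sqrt hne (n := 1)).contMDiffAt.comp p h
  refine this.congr_of_eventuallyEq (Eventually.of_forall fun x => ?_)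
  simp only [Function.comp, real_inner_self_eq_norm_sq, Real.sqrt_sq (norm_nonneg _)]

theorem contMDiff_unitGrad {f : M → ℝ} (hf : ContMDiff I 𝓘(ℝ, ℝ) 2 f)
    (hcrit : ∀ x : M, ¬ IsCriticalPoint I f x) :
    ContMDiff I I.tangent 1 (fun x => (⟨x, unitGrad I f x⟩ : TangentBundle I M)) :=
  ((contMDiff_norm_grad hf hcrit).inv₀ fun x => (norm_grad_pos (hcrit x)).ne').smul_section
    (contMDiff_grad hf)

end MetricFunction

namespace MetricFunction

section LocalFlow

open Set Filter Topology Metric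

variable {E : Type*} [NormedAddCommGroup E] [NormedSpace ℝ E]
  {H : Type*} [TopologicalSpace H] {I : ModelWithCorners ℝ E H}
  {M : Type*} [TopologicalSpace M] [ChartedSpace H M] [IsManifold I 1 M]
  {v : (x : M) → TangentSpace I x}

/-- A curve in a chart that solves the equation of a vector field read in the chart gives an
integral curve of the vector field. -/
theorem isMIntegralCurveOn_extChartAt_symm_comp {x₀ : M} {f : ℝ → E} {s : Set ℝ}
    (hmem : ∀ t ∈ s, f t ∈ interior (extChartAt I x₀).target)
    (hf : ∀ t ∈ s, HasDerivAt f (tangentCoordChange I ((extChartAt I x₀).symm (f t)) x₀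
      ((extChartAt I x₀).symm (f t)) (v ((extChartAt I x₀).symm (f t)))) t) :
    IsMIntegralCurveOn ((extChartAt I x₀).symm ∘ f) v s := by
  intro t ht
  let xₜ : M := (extChartAt I x₀).symm (f t)
  have h := hf t ht
  have hf3 := hmem t ht
  have hf3' := interior_subset hf3
  have hft1 := mem_preimage.mp <|
    mem_of_mem_of_subset hf3' (extChartAt I x₀).target_subset_preimage_source
  have hft2 := mem_extChartAt_source (I := I) xₜ
  let w : E := v xₜ
  have hw : tangentCoordChange I x₀ xₜ xₜ (tangentCoordChange I xₜ x₀ xₜ w) = w := by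
    rw [tangentCoordChange_comp ⟨⟨hft2, hft1⟩, hft2⟩, tangentCoordChange_self hft2]
  have key : HasDerivAt ((extChartAt I xₜ ∘ (extChartAt I x₀).symm) ∘ f) w t := by
    rw [← hw]
    apply HasFDerivAt.comp_hasDerivAt _ _ h
    apply HasFDerivWithinAt.hasFDerivAt (s := range I) _ <|
      mem_nhds_iff.mpr ⟨interior (extChartAt I x₀).target,
        subset_trans interior_subset (extChartAt_target_subset_range ..),
        isOpen_interior, hf3⟩
    rw [← (extChartAt I x₀).right_inv hf3']
    exact hasFDerivWithinAt_tangentCoordChange ⟨hft1, hft2⟩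
  apply HasMFDerivAt.hasMFDerivWithinAt
  refine ⟨(continuousAt_extChartAt_symm'' hf3').comp h.continuousAt, ?_⟩
  have key' := key.hasFDerivAt.hasFDerivWithinAt (s := range 𝓘(ℝ, ℝ))
  exact key'

/-- Local flow of a `C^1` vector field, continuous in the initial point. -/
theorem exists_local_flow [CompleteSpace E] [BoundarylessManifold I M] {p : M}
    (hv : ContMDiffAt I I.tangent 1 (fun x => (⟨x, v x⟩ : TangentBundle I M)) p) :
    ∃ U ∈ 𝓝 p, ∃ ε > 0, ∃ α : M → ℝ → M,
      (∀ x ∈ U, α x 0 = x ∧ IsMIntegralCurveOn (α x) v (Ioo (-ε) ε)) ∧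
      ∀ t ∈ Ioo (-ε) ε, ContinuousOn (fun x => α x t) U := by
  have hp : I.IsInteriorPoint p := BoundarylessManifold.isInteriorPoint
  rw [contMDiffAt_iff] at hv
  obtain ⟨_, hv⟩ := hv
  obtain ⟨ε, hε, a, r, L, K, hr, hpl⟩ := IsPicardLindelof.of_contDiffAt_one
    (hv.contDiffAt (range_mem_nhds_isInteriorPoint hp)).snd
  obtain ⟨α, hα, hαc⟩ :=
    (hpl 0).exists_forall_mem_closedBall_eq_hasDerivWithinAt_continuousOn
  set x₀ : E := extChartAt I p p with hx₀
  have hnhds : closedBall x₀ (r : ℝ) ×ˢ Icc (0 - ε) (0 + ε) ∈ 𝓝 (x₀, (0 : ℝ)) :=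
    prod_mem_nhds (closedBall_mem_nhds _ hr) (Icc_mem_nhds (by linarith) (by linarith))
  have hint : interior (extChartAt I p).target ∈ 𝓝 (α (x₀, 0)) := by
    rw [(hα x₀ (mem_closedBall_self r.2)).1]
    exact isOpen_interior.mem_nhds ((I.isInteriorPoint_iff).mp hp)
  have hev : ∀ᶠ z in 𝓝 (x₀, (0 : ℝ)), α z ∈ interior (extChartAt I p).target ∧
      z ∈ closedBall x₀ (r : ℝ) ×ˢ Icc (0 - ε) (0 + ε) :=
    ((hαc.continuousAt hnhds).eventually_mem hint).and hnhds
  obtain ⟨δ, hδ, hball⟩ := Metric.eventually_nhds_iff_ball.1 hev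
  have hball' : ∀ x ∈ ball x₀ δ, ∀ t ∈ Ioo (-δ) δ, α (x, t) ∈ interior (extChartAt I p).target ∧
      x ∈ closedBall x₀ (r : ℝ) ∧ t ∈ Icc (0 - ε) (0 + ε) := by
    intro x hx t ht
    have := hball (x, t) (by
      rw [← ball_prod_same]
      refine ⟨hx, ?_⟩
      rw [Real.ball_eq_Ioo]
      simpa using ht)
    exact ⟨this.1, this.2.1, this.2.2⟩
  have h0 : (0 : ℝ) ∈ Ioo (-δ) δ := ⟨by linarith, hδ⟩
  refine ⟨(extChartAt I p).source ∩ extChartAt I p ⁻¹' ball x₀ δ, ?_, δ, hδ,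
    fun x => (extChartAt I p).symm ∘ fun t => α (extChartAt I p x, t), ?_, ?_⟩
  · exact inter_mem (extChartAt_source_mem_nhds p)
      ((continuousAt_extChartAt p).preimage_mem_nhds (ball_mem_nhds _ hδ))
  · rintro x ⟨hxs, hx⟩
    refine ⟨?_, ?_⟩
    · have h := (hα _ (hball' _ hx 0 h0).2.1).1
      change (extChartAt I p).symm (α (extChartAt I p x, 0)) = x
      change α (extChartAt I p x, 0) = extChartAt I p x at h
      rw [h, (extChartAt I p).left_inv hxs]
    · apply isMIntegralCurveOn_extChartAt_symm_comp
      · exact fun t ht => (hball' _ hx t ht).1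
      · intro t ht
        refine ((hα _ (hball' _ hx t ht).2.1).2 t (hball' _ hx t ht).2.2).hasDerivAt ?_
        filter_upwards [isOpen_Ioo.mem_nhds ht] with s hs
        exact (hball' _ hx s hs).2.2
  · intro t ht
    refine (continuousOn_extChartAt_symm p).comp (t := (extChartAt I p).target) ?_ ?_
    · refine hαc.comp (ContinuousOn.prodMk ((continuousOn_extChartAt p).mono inter_subset_left)
        continuousOn_const) ?_
      rintro x ⟨hxs, hx⟩
      exact ⟨(hball' _ hx t ht).2.1, (hball' _ hx t ht).2.2⟩
    · rintro x ⟨hxs, hx⟩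
      exact interior_subset (hball' _ hx t ht).1

end LocalFlow

end MetricFunction

namespace MetricFunction

open Set Filter Topology MeasureTheory
open scoped ENNReal

section CurveRegularity

variable {E : Type*} [NormedAddCommGroup E] [NormedSpace ℝ E]
  {H : Type*} [TopologicalSpace H] {I : ModelWithCorners ℝ E H}
  {M : Type*} [TopologicalSpace M] [ChartedSpace H M] [IsManifold I 1 M]
  {v : (x : M) → TangentSpace I x}

theorem contMDiffAt_of_isMIntegralCurveAt
    (hv : ContMDiff I I.tangent 1 (fun x => (⟨x, v x⟩ : TangentBundle I M)))
    {γ : ℝ → M} {t₀ : ℝ} (hγ : IsMIntegralCurveAt γ v t₀) : ContMDiffAt 𝓘(ℝ, ℝ) I 1 γ t₀ := by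
  rw [contMDiffAt_iff]
  refine ⟨hγ.continuousAt, ?_⟩
  simp only [mfld_simps, contDiffWithinAt_univ]
  let e := trivializationAt E (TangentSpace I : M → Type _) (γ t₀)
  let d : ℝ → E := fun t => (e (⟨γ t, v (γ t)⟩ : TangentBundle I M)).2
  have hcont : ∀ᶠ t in 𝓝 t₀, ContinuousAt γ t := by
    filter_upwards [eventually_eventually_nhds.2 hγ] with t ht
    exact IsMIntegralCurveAt.continuousAt ht
  have hbase : ∀ᶠ t in 𝓝 t₀, γ t ∈ e.baseSet :=
    hγ.continuousAt.eventually_mem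
      (e.open_baseSet.mem_nhds (FiberBundle.mem_baseSet_trivializationAt' (γ t₀)))
  have hd : ∀ᶠ t in 𝓝 t₀, ContinuousAt d t := by
    filter_upwards [hcont, hbase] with t h1 h2
    have h3 : ContinuousAt (fun t => (⟨γ t, v (γ t)⟩ : TangentBundle I M)) t :=
      ContinuousAt.comp (g := fun x => (⟨x, v x⟩ : TangentBundle I M)) hv.continuous.continuousAt h1
    exact ((e.continuousAt (e.mem_source.2 h2)).comp h3).snd
  have hder := hγ.eventually_hasDerivAt
  refine contDiffAt_one_iff.2 ⟨fun t => ContinuousLinearMap.toSpanSingleton ℝ (d t),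
    _, (hd.and hder), ?_, ?_⟩
  · intro t ht
    have := (ContinuousLinearMap.toSpanSingletonCLE (𝕜 := ℝ) (E := E)).continuous
    exact (this.continuousAt.comp ht.1).continuousWithinAt
  · intro t ht
    exact ht.2.hasFDerivAt

end CurveRegularity

section

variable {E : Type*} [NormedAddCommGroup E] [NormedSpace ℝ E]
  {H : Type*} [TopologicalSpace H] {I : ModelWithCorners ℝ E H}
  {M : Type*} [EMetricSpace M] [ChartedSpace H M] [IsManifold I 1 M]
  [Bundle.RiemannianBundle (fun x : M ↦ TangentSpace I x)] [IsRiemannianManifold I M]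
  {v : (x : M) → TangentSpace I x}

theorem edist_le_of_isMIntegralCurveOn
    (hv : ContMDiff I I.tangent 1 (fun x => (⟨x, v x⟩ : TangentBundle I M)))
    (hnorm : ∀ x, ‖v x‖ = 1) {γ : ℝ → M} {a b : ℝ} (hγ : IsMIntegralCurveOn γ v (Ioo a b))
    {s t : ℝ} (hs : s ∈ Ioo a b) (ht : t ∈ Ioo a b) (hst : s ≤ t) :
    edist (γ s) (γ t) ≤ ENNReal.ofReal (t - s) := by
  have hsub : Icc s t ⊆ Ioo a b := fun u hu => ⟨hs.1.trans_le hu.1, hu.2.trans_lt ht.2⟩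
  have hat : ∀ u ∈ Icc s t, IsMIntegralCurveAt γ v u := fun u hu =>
    hγ.isMIntegralCurveAt (isOpen_Ioo.mem_nhds (hsub hu))
  rw [IsRiemannianManifold.out (I := I) (γ s) (γ t)]
  refine (Manifold.riemannianEDist_le_pathELength (I := I) (γ := γ) (a := s) (b := t)
    (fun u hu => (contMDiffAt_of_isMIntegralCurveAt hv (hat u hu)).contMDiffWithinAt)
    rfl rfl hst).trans ?_
  rw [Manifold.pathELength_eq_lintegral_mfderiv_Icc]
  calc ∫⁻ u in Icc s t, ‖mfderiv 𝓘(ℝ, ℝ) I γ u 1‖ₑ = ∫⁻ u in Icc s t, 1 := by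
        refine setLIntegral_congr_fun measurableSet_Icc fun u hu => ?_
        rw [(hat u hu).hasMFDerivAt.mfderiv, ← ofReal_norm]
        have : ((1 : ℝ →L[ℝ] ℝ).smulRight (v (γ u)) : ℝ →L[ℝ] TangentSpace I (γ u)) 1 = v (γ u) := by
          simp
        erw [this]
        rw [hnorm, ENNReal.ofReal_one]
    _ ≤ ENNReal.ofReal (t - s) := by simp

end

section GlobalFlow

variable {E : Type*} [NormedAddCommGroup E] [NormedSpace ℝ E] [CompleteSpace E]
  {H : Type*} [TopologicalSpace H] {I : ModelWithCorners ℝ E H}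
  {M : Type*} [EMetricSpace M] [ChartedSpace H M] [IsManifold I 1 M] [BoundarylessManifold I M]
  [Bundle.RiemannianBundle (fun x : M ↦ TangentSpace I x)] [IsRiemannianManifold I M]
  [CompleteSpace M] {v : (x : M) → TangentSpace I x}

/-- An integral curve of a unit field on a bounded interval comes close to its ends with a
uniform time of existence. -/
theorem exists_restart_of_isMIntegralCurveOn
    (hv : ContMDiff I I.tangent 1 (fun x => (⟨x, v x⟩ : TangentBundle I M)))
    (hnorm : ∀ x, ‖v x‖ = 1) {γ : ℝ → M} {a b : ℝ} (hγ : IsMIntegralCurveOn γ v (Ioo a b))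
    {u : ℕ → ℝ} (hu : ∀ n, u n ∈ Ioo a b) {c : ℝ} (huc : Tendsto u atTop (𝓝 c)) :
    ∃ ε > 0, ∃ t ∈ Ioo a b, |t - c| < ε ∧
      ∃ β : ℝ → M, β 0 = γ t ∧ IsMIntegralCurveOn β v (Ioo (-ε) ε) := by
  have hdist : ∀ s ∈ Ioo a b, ∀ t ∈ Ioo a b, edist (γ s) (γ t) ≤ edist s t := by
    intro s hs t ht
    rcases le_total s t with h | h
    · refine (edist_le_of_isMIntegralCurveOn hv hnorm hγ hs ht h).trans ?_
      rw [edist_dist, Real.dist_eq, abs_sub_comm, abs_of_nonneg (by linarith)]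
    · rw [edist_comm]
      refine (edist_le_of_isMIntegralCurveOn hv hnorm hγ ht hs h).trans ?_
      rw [edist_dist, Real.dist_eq, abs_of_nonneg (by linarith)]
  have hcauchy : CauchySeq (fun n => γ (u n)) := by
    rw [EMetric.cauchySeq_iff]
    intro ε hε
    obtain ⟨N, hN⟩ := EMetric.cauchySeq_iff.1 huc.cauchySeq ε hε
    exact ⟨N, fun m hm n hn => (hdist _ (hu m) _ (hu n)).trans_lt (hN m hm n hn)⟩
  obtain ⟨q, hq⟩ := cauchySeq_tendsto_of_complete hcauchy
  obtain ⟨U, hU, ε, hε, α, hα, -⟩ := exists_local_flow (hv q)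
  obtain ⟨n, hn, hn'⟩ := ((hq.eventually_mem hU).and
    (huc.eventually_mem (Metric.ball_mem_nhds c hε))).exists
  exact ⟨ε, hε, u n, hu n, hn', α (γ (u n)), hα _ hn⟩

theorem exists_isMIntegralCurve_of_norm_eq_one
    (hv : ContMDiff I I.tangent 1 (fun x => (⟨x, v x⟩ : TangentBundle I M)))
    (hnorm : ∀ x, ‖v x‖ = 1) (x : M) : ∃ γ : ℝ → M, γ 0 = x ∧ IsMIntegralCurve γ v := by
  rw [exists_isMIntegralCurve_iff_exists_isMIntegralCurveOn_Ioo hv]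
  by_contra! hcon
  obtain ⟨A, hA⟩ := hcon
  let S : Set ℝ := {a | 0 < a ∧ ∃ γ, γ 0 = x ∧ IsMIntegralCurveOn γ v (Ioo (-a) a)}
  have hSne : S.Nonempty := by
    obtain ⟨U, hU, ε, hε, α, hα, -⟩ := exists_local_flow (hv x)
    exact ⟨ε, hε, α x, hα x (mem_of_mem_nhds hU)⟩
  have hSb : BddAbove S := by
    refine ⟨A, fun a ha => le_of_not_gt fun h => ?_⟩
    obtain ⟨ha0, γ, h0, hγ⟩ := ha
    exact hA γ h0 (hγ.mono (Ioo_subset_Ioo (by linarith) (by linarith)))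
  set B := sSup S with hB
  have hBpos : 0 < B := by
    obtain ⟨a, ha⟩ := hSne
    exact ha.1.trans_le (le_csSup hSb ha)
  have hlt : ∀ a < B, ∃ γ, γ 0 = x ∧ IsMIntegralCurveOn γ v (Ioo (-a) a) := by
    intro a ha
    obtain ⟨b, hb, hab⟩ := exists_lt_of_lt_csSup hSne ha
    obtain ⟨hb0, γ, h0, hγ⟩ := hb
    exact ⟨γ, h0, hγ.mono (Ioo_subset_Ioo (by linarith) (by linarith))⟩
  have : Nonempty M := ⟨x⟩
  choose! γ' h0' hγ' using hlt
  let γ : ℝ → M := fun t => γ' ((|t| + B) / 2) t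
  have hγeq : ∀ a < B, EqOn γ (γ' a) (Ioo (-a) a) := by
    intro a ha t ht
    have ht' : |t| < a := abs_lt.2 ht
    have hb : (|t| + B) / 2 < B := by linarith
    have hc : ∀ c, |t| < c → t ∈ Ioo (-c) c := fun c hc => abs_lt.1 hc
    have hc0 : 0 < min a ((|t| + B) / 2) := by
      have := abs_nonneg t
      exact lt_min (by linarith) (by linarith)
    refine isMIntegralCurveOn_Ioo_eqOn_of_contMDiff_boundaryless
      (a := -min a ((|t| + B) / 2)) (b := min a ((|t| + B) / 2)) (t₀ := 0)
      ⟨by linarith, hc0⟩ hv ((hγ' _ hb).mono ?_) ((hγ' _ ha).mono ?_)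
      ((h0' _ hb).trans (h0' _ ha).symm) (hc _ (lt_min ht' (by linarith)))
    · exact Ioo_subset_Ioo (neg_le_neg (min_le_right _ _)) (min_le_right _ _)
    · exact Ioo_subset_Ioo (neg_le_neg (min_le_left _ _)) (min_le_left _ _)
  have hγ0 : γ 0 = x := h0' _ (by simp only [abs_zero]; linarith)
  have hγ : IsMIntegralCurveOn γ v (Ioo (-B) B) := by
    rw [isMIntegralCurveOn_iff_isMIntegralCurveAt isOpen_Ioo]
    intro t ht
    have ht' : |t| < B := abs_lt.2 ht
    have hb : (|t| + B) / 2 < B := by linarith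
    have hmem : t ∈ Ioo (-((|t| + B) / 2)) ((|t| + B) / 2) := abs_lt.1 (by linarith)
    have h1 := (hγ' _ hb).isMIntegralCurveAt (isOpen_Ioo.mem_nhds hmem)
    have heq : ∀ᶠ s in 𝓝 t, γ s = γ' ((|t| + B) / 2) s := by
      filter_upwards [isOpen_Ioo.mem_nhds hmem] with s hs using hγeq _ hb hs
    filter_upwards [h1, eventually_eventually_nhds.2 heq] with s hs hs'
    have hss := hs'.self_of_nhds
    rw [hss]
    exact hs.congr_of_eventuallyEq hs'
  have hseq : Tendsto (fun n : ℕ => B - B / (n + 2)) atTop (𝓝 (B - 0)) := by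
    refine tendsto_const_nhds.sub ?_
    exact tendsto_const_nhds.div_atTop
      (tendsto_atTop_add_const_right _ _ tendsto_natCast_atTop_atTop)
  have hmem : ∀ n : ℕ, B - B / (n + 2) ∈ Ioo 0 B := by
    intro n
    have h2 : (0 : ℝ) < n + 2 := by positivity
    have : B / (n + 2) < B := by
      rw [div_lt_iff₀ h2]
      nlinarith
    exact ⟨by linarith, by linarith [div_pos hBpos h2]⟩
  rw [sub_zero] at hseq
  obtain ⟨ε₁, hε₁, t₁, ht₁, hd₁, β₁, hβ₁, hi₁⟩ := exists_restart_of_isMIntegralCurveOn hv hnorm hγ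
    (u := fun n => B - B / (n + 2)) (fun n => ⟨by linarith [(hmem n).1], (hmem n).2⟩) hseq
  obtain ⟨ε₂, hε₂, t₂, ht₂, hd₂, β₂, hβ₂, hi₂⟩ := exists_restart_of_isMIntegralCurveOn hv hnorm hγ
    (u := fun n => -(B - B / (n + 2))) (fun n => ⟨by linarith [(hmem n).2], by linarith [(hmem n).1]⟩)
    hseq.neg
  rw [abs_lt] at hd₁ hd₂
  have hs₁ : IsMIntegralCurveOn (β₁ ∘ (· - t₁)) v (Ioo (t₁ - ε₁) (t₁ + ε₁)) := by
    refine (isMIntegralCurveOn_comp_sub (dt := t₁).2 hi₁).mono fun t ht => ?_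
    exact ⟨by linarith [ht.1], by linarith [ht.2]⟩
  have hs₂ : IsMIntegralCurveOn (β₂ ∘ (· - t₂)) v (Ioo (t₂ - ε₂) (t₂ + ε₂)) := by
    refine (isMIntegralCurveOn_comp_sub (dt := t₂).2 hi₂).mono fun t ht => ?_
    exact ⟨by linarith [ht.1], by linarith [ht.2]⟩
  have g₁ := isMIntegralCurveOn_piecewise hv hγ hs₁ (t₀ := t₁)
    ⟨ht₁, by linarith, by linarith⟩ (by simp [hβ₁])
  set γ₁ := piecewise (Ioo (-B) B) γ (β₁ ∘ (· - t₁)) with hγ₁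
  have g₁' : IsMIntegralCurveOn γ₁ v (Ioo (-B) (t₁ + ε₁)) := by
    refine g₁.mono fun t ht => ?_
    by_cases h : t < B
    · exact Or.inl ⟨ht.1, h⟩
    · exact Or.inr ⟨by linarith [ht₁.2], ht.2⟩
  have hγ₁eq : ∀ t ∈ Ioo (-B) B, γ₁ t = γ t := fun t ht => piecewise_eq_of_mem _ _ _ ht
  have g₂ := isMIntegralCurveOn_piecewise hv g₁' hs₂ (t₀ := t₂)
    ⟨⟨ht₂.1, by linarith [ht₂.2]⟩, by linarith, by linarith⟩ (by simp [hβ₂, hγ₁eq t₂ ht₂])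
  set γ₂ := piecewise (Ioo (-B) (t₁ + ε₁)) γ₁ (β₂ ∘ (· - t₂)) with hγ₂
  set c := min (t₁ + ε₁) (-(t₂ - ε₂)) with hc
  have hcB : B < c := lt_min (by linarith) (by linarith)
  have hcS : c ∈ S := by
    refine ⟨hBpos.trans hcB, γ₂, ?_, g₂.mono fun t ht => ?_⟩
    · rw [hγ₂, piecewise_eq_of_mem _ _ _ (show (0 : ℝ) ∈ Ioo (-B) (t₁ + ε₁) from
        ⟨by linarith, by linarith⟩),
        hγ₁eq 0 ⟨by linarith, hBpos⟩, hγ0]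
    · have h1 := min_le_left (t₁ + ε₁) (-(t₂ - ε₂))
      have h2 := min_le_right (t₁ + ε₁) (-(t₂ - ε₂))
      by_cases h : -B < t
      · exact Or.inl ⟨h, by linarith [ht.2]⟩
      · exact Or.inr ⟨by linarith [ht.1], by linarith [ht₂.1]⟩
  exact absurd (le_csSup hSb hcS) (not_le.2 hcB)

end GlobalFlow

end MetricFunction

namespace MetricFunction

open Set Filter Topology

section

variable {E : Type*} [NormedAddCommGroup E] [NormedSpace ℝ E]
  {H : Type*} [TopologicalSpace H] {I : ModelWithCorners ℝ E H}
  {M : Type*} [EMetricSpace M] [ChartedSpace H M]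

/-- A global flow of the vector field `v` that moves points at speed at most one. -/
structure IsUnitSpeedFlow (v : (x : M) → TangentSpace I x) (φ : M → ℝ → M) : Prop where
  zero : ∀ x, φ x 0 = x
  isMIntegralCurve : ∀ x, IsMIntegralCurve (φ x) v
  add : ∀ x s t, φ (φ x s) t = φ x (s + t)
  edist_le : ∀ x s t, edist (φ x s) (φ x t) ≤ edist s t
  continuous : ∀ t, Continuous fun x => φ x t

variable [CompleteSpace E] [IsManifold I 1 M] [BoundarylessManifold I M]
  [Bundle.RiemannianBundle (fun x : M ↦ TangentSpace I x)] [IsRiemannianManifold I M]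
  [CompleteSpace M] {v : (x : M) → TangentSpace I x}

theorem exists_isUnitSpeedFlow
    (hv : ContMDiff I I.tangent 1 (fun x => (⟨x, v x⟩ : TangentBundle I M)))
    (hnorm : ∀ x, ‖v x‖ = 1) : ∃ φ : M → ℝ → M, IsUnitSpeedFlow v φ := by
  choose φ h0 hφ using exists_isMIntegralCurve_of_norm_eq_one hv hnorm
  have hadd : ∀ x s t, φ (φ x s) t = φ x (s + t) := by
    intro x s t
    have := isMIntegralCurve_Ioo_eq_of_contMDiff_boundaryless (t₀ := 0) hv (hφ (φ x s))
      ((hφ x).comp_add s) (by simp [h0])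
    rw [this, Function.comp_apply, add_comm]
  have hedist : ∀ x s t, edist (φ x s) (φ x t) ≤ edist s t := by
    intro x s t
    wlog h : s ≤ t generalizing s t
    · rw [edist_comm, edist_comm s]
      exact this t s (le_of_not_ge h)
    refine (edist_le_of_isMIntegralCurveOn hv hnorm ((hφ x).isMIntegralCurveOn
      (Ioo (s - 1) (t + 1))) ⟨by linarith, by linarith⟩ ⟨by linarith, by linarith⟩ h).trans ?_
    rw [edist_dist, Real.dist_eq, abs_sub_comm, abs_of_nonneg (by linarith)]
  refine ⟨φ, h0, hφ, hadd, hedist, fun t => continuous_iff_continuousAt.2 fun x => ?_⟩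
  refine isPreconnected_univ.induction₂
    (fun s t => ContinuousAt (fun y => φ y s) x ↔ ContinuousAt (fun y => φ y t) x)
    (fun s _ => ?_) (fun _ _ _ _ _ _ h1 h2 => h1.trans h2) (fun _ _ _ _ h => h.symm)
    (mem_univ (0 : ℝ)) (mem_univ t) |>.1 (by simp only [h0]; exact continuousAt_id)
  rw [nhdsWithin_univ]
  obtain ⟨U, hU, ε, hε, α, hα, hαc⟩ := exists_local_flow (hv (φ x s))
  have hαφ : ∀ y ∈ U, ∀ τ ∈ Ioo (-ε) ε, φ y τ = α y τ := fun y hy τ hτ =>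
    isMIntegralCurveOn_Ioo_eqOn_of_contMDiff_boundaryless (t₀ := 0) ⟨by linarith, hε⟩ hv
      ((hφ y).isMIntegralCurveOn _) (hα y hy).2 ((h0 y).trans (hα y hy).1.symm) hτ
  have hloc : ∀ τ ∈ Ioo (-ε) ε, ∀ y ∈ interior U, ContinuousAt (fun z => φ z τ) y := by
    intro τ hτ y hy
    have hy' := mem_interior_iff_mem_nhds.1 hy
    refine ((hαc τ hτ).continuousAt hy').congr ?_
    filter_upwards [hy'] with z hz using (hαφ z hz τ hτ).symm
  have hstep : ∀ a b, φ x a ∈ interior U → b - a ∈ Ioo (-ε) ε →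
      ContinuousAt (fun y => φ y a) x → ContinuousAt (fun y => φ y b) x := by
    intro a b ha hab hc
    have := ContinuousAt.comp (g := fun z => φ z (b - a)) (f := fun y => φ y a) (x := x)
      (hloc _ hab _ ha) hc
    simpa only [Function.comp_def, hadd, add_sub_cancel] using this
  filter_upwards [(hφ x).continuous.continuousAt.eventually_mem
    (isOpen_interior.mem_nhds (mem_interior_iff_mem_nhds.2 hU)),
    Ioo_mem_nhds (show s - ε < s by linarith) (show s < s + ε by linarith)] with t ht ht'
  exact ⟨hstep s t (mem_interior_iff_mem_nhds.2 hU) ⟨by linarith [ht'.1], by linarith [ht'.2]⟩,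
    hstep t s ht ⟨by linarith [ht'.2], by linarith [ht'.1]⟩⟩

end

end MetricFunction

namespace MetricFunction

open Set Filter Topology Metric Manifold
open scoped NNReal ENNReal

section

attribute [local instance] normedAddCommGroupTangentSpaceVectorSpace
attribute [local instance] normedSpaceTangentSpaceVectorSpace

variable {E : Type*} [NormedAddCommGroup E] [NormedSpace ℝ E]
  {H : Type*} [TopologicalSpace H] (I : ModelWithCorners ℝ E H)
  {M : Type*} [EMetricSpace M] [ChartedSpace H M] [IsManifold I 1 M]
  [Bundle.RiemannianBundle (fun x : M ↦ TangentSpace I x)] [IsRiemannianManifold I M]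
  [IsContinuousRiemannianBundle E (fun x : M ↦ TangentSpace I x)]

theorem exists_lipschitzOnWith_extChartAt_symm [BoundarylessManifold I M] (x : M) :
    ∃ C : ℝ≥0, ∃ s ∈ 𝓝 (extChartAt I x x), LipschitzOnWith C (extChartAt I x).symm s := by
  obtain ⟨C, C_pos, hC'⟩ := eventually_enorm_mfderivWithin_symm_extChartAt_lt I x
  have hC : ∀ᶠ y in 𝓝[range I] (extChartAt I x x),
      ∀ w : E, ‖(mfderiv[range I] (extChartAt I x).symm y : E → _) w‖ₑ ≤ C * ‖w‖ₑ := by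
    filter_upwards [hC'] with y hy w
    let D : E →L[ℝ] TangentSpace I ((extChartAt I x).symm y) :=
      mfderiv[range I] (extChartAt I x).symm y
    have hD : ‖D‖ₑ < C := hy
    exact (D.le_opENorm w).trans (by gcongr)
  obtain ⟨r, r_pos, hr⟩ : ∃ r > 0,
      ball (extChartAt I x x) r ∩ range I ⊆ (extChartAt I x).target ∩
        {y | ∀ w : E, ‖(mfderiv[range I] (extChartAt I x).symm y : E → _) w‖ₑ ≤ C * ‖w‖ₑ} :=
    mem_nhdsWithin_iff.1 (inter_mem (extChartAt_target_mem_nhdsWithin x) hC)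
  refine ⟨C, ball (extChartAt I x x) r ∩ range I,
    inter_mem (ball_mem_nhds _ r_pos)
      (range_mem_nhds_isInteriorPoint BoundarylessManifold.isInteriorPoint), ?_⟩
  intro y hy z hz
  let η := ContinuousAffineMap.lineMap (R := ℝ) y z
  set γ := (extChartAt I x).symm ∘ η
  have hη : Icc 0 1 ⊆ ⇑η ⁻¹' ((extChartAt I x).target ∩
        {y | ∀ w : E, ‖(mfderiv[range I] (extChartAt I x).symm y : E → _) w‖ₑ ≤ C * ‖w‖ₑ}) := by
    simp only [← image_subset_iff, ContinuousAffineMap.coe_lineMap_eq,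
     ← segment_eq_image_lineMap, η]
    apply Subset.trans _ hr
    exact ((convex_ball _ _).inter I.convex_range).segment_subset hy hz
  simp only [preimage_inter, subset_inter_iff] at hη
  have η_smooth : CMDiff[Icc 0 1] 1 η := by
    apply ContMDiff.contMDiffOn
    rw [contMDiff_iff_contDiff]
    exact ContinuousAffineMap.contDiff _
  rw [IsRiemannianManifold.out (I := I)]
  have : riemannianEDist I ((extChartAt I x).symm y) ((extChartAt I x).symm z)
      ≤ pathELength I γ 0 1 := by
    apply riemannianEDist_le_pathELength _ _ _ zero_le_one
    · exact (contMDiffOn_extChartAt_symm x).comp η_smooth hη.1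
    · simp [γ, η, ContinuousAffineMap.coe_lineMap_eq]
    · simp [γ, η, ContinuousAffineMap.coe_lineMap_eq]
  apply this.trans
  rw [← lintegral_fderiv_lineMap_eq_edist, pathELength_eq_lintegral_mfderivWithin_Icc,
    ← MeasureTheory.lintegral_const_mul' _ _ ENNReal.coe_ne_top]
  apply MeasureTheory.setLIntegral_mono' measurableSet_Icc (fun t ht ↦ ?_)
  have : mfderiv[Icc 0 1] γ t =
      (mfderiv[range I] (extChartAt I x).symm (η t)) ∘L (mfderiv[Icc 0 1] η t) := by
    apply mfderivWithin_comp
    · exact mdifferentiableWithinAt_extChartAt_symm (hη.1 ht)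
    · exact η_smooth.mdifferentiableOn one_ne_zero t ht
    · exact hη.1.trans (preimage_mono (extChartAt_target_subset_range x))
    · rw [uniqueMDiffWithinAt_iff_uniqueDiffWithinAt]
      exact uniqueDiffOn_Icc zero_lt_one t ht
  have : mfderiv[Icc 0 1] γ t 1 =
      (mfderiv[range I] (extChartAt I x).symm (η t)) (mfderiv[Icc 0 1] η t 1) := congr($this 1)
  rw [this]
  refine (hη.2 ht _).trans ?_
  gcongr
  simp only [mfderivWithin_eq_fderivWithin]
  exact le_of_eq rfl

end

theorem exists_prod_continuousLinearEquiv {D : EuclideanSpace ℝ (Fin 2) →L[ℝ] ℝ} (hD : D ≠ 0) :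
    ∃ (l : EuclideanSpace ℝ (Fin 2) →L[ℝ] ℝ) (A : EuclideanSpace ℝ (Fin 2) ≃L[ℝ] ℝ × ℝ),
      (A : EuclideanSpace ℝ (Fin 2) →L[ℝ] ℝ × ℝ) = D.prod l := by
  let b := EuclideanSpace.basisFun (Fin 2) ℝ
  let l : EuclideanSpace ℝ (Fin 2) →L[ℝ] ℝ :=
    D (b 0) • EuclideanSpace.proj 1 - D (b 1) • EuclideanSpace.proj 0
  have hDx : ∀ x, D x = x 0 * D (b 0) + x 1 * D (b 1) := by
    intro x
    conv_lhs => rw [← b.sum_repr x, Fin.sum_univ_two, map_add, map_smul, map_smul]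
    simp [b]
  have hl : ∀ x, l x = D (b 0) * x 1 - D (b 1) * x 0 := fun x => by simp [l]
  have hne : D (b 0) ^ 2 + D (b 1) ^ 2 ≠ 0 := by
    intro h
    apply hD
    ext x
    have h0 : D (b 0) = 0 := by nlinarith [sq_nonneg (D (b 0)), sq_nonneg (D (b 1))]
    have h1 : D (b 1) = 0 := by nlinarith [sq_nonneg (D (b 0)), sq_nonneg (D (b 1))]
    rw [hDx, h0, h1]
    simp
  have hinj : Function.Injective (D.prod l : EuclideanSpace ℝ (Fin 2) →ₗ[ℝ] ℝ × ℝ) := by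
    rw [injective_iff_map_eq_zero]
    intro x hx
    have h1 : D x = 0 := congrArg Prod.fst hx
    have h2 : l x = 0 := congrArg Prod.snd hx
    rw [hDx] at h1
    rw [hl] at h2
    have h3 : x 0 = 0 := (mul_eq_zero.1 (show (D (b 0) ^ 2 + D (b 1) ^ 2) * x 0 = 0 by
      linear_combination D (b 0) * h1 - D (b 1) * h2)).resolve_left hne
    have h4 : x 1 = 0 := (mul_eq_zero.1 (show (D (b 0) ^ 2 + D (b 1) ^ 2) * x 1 = 0 by
      linear_combination D (b 1) * h1 + D (b 0) * h2)).resolve_left hne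
    ext i
    fin_cases i
    · exact h3
    · exact h4
  refine ⟨l, (LinearEquiv.ofInjectiveOfFinrankEq _ hinj (by simp)).toContinuousLinearEquiv, ?_⟩
  ext x <;> rfl

section

variable {M : Type*} [EMetricSpace M] [ChartedSpace (EuclideanSpace ℝ (Fin 2)) M]
  [IsManifold (𝓡 2) 1 M] [Bundle.RiemannianBundle (fun x : M ↦ TangentSpace (𝓡 2) x)]
  [IsRiemannianManifold (𝓡 2) M]
  [IsContinuousRiemannianBundle (EuclideanSpace ℝ (Fin 2)) (fun x : M ↦ TangentSpace (𝓡 2) x)]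

/-- Around a noncritical point, a function is the first coordinate of a chart whose inverse is
Lipschitz. -/
theorem exists_chart_fst_eq {f : M → ℝ} {p : M} (hf : ContMDiffAt (𝓡 2) 𝓘(ℝ, ℝ) 1 f p)
    (hp : ¬ IsCriticalPoint (𝓡 2) f p) :
    ∃ e : OpenPartialHomeomorph M (ℝ × ℝ), p ∈ e.source ∧ (∀ x ∈ e.source, (e x).1 = f x) ∧
      ∃ K : ℝ≥0, ∃ s ∈ 𝓝 (e p), LipschitzOnWith K e.symm s := by
  let c := chartAt (EuclideanSpace ℝ (Fin 2)) p
  have hc : ContDiffAt ℝ 1 (f ∘ c.symm) (c p) := by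
    have := (contMDiffAt_iff.1 hf).2
    simp only [mfld_simps, contDiffWithinAt_univ] at this
    exact this
  have hD : fderiv ℝ (f ∘ c.symm) (c p) ≠ 0 := by
    intro h
    apply hp
    have h1 := (hf.mdifferentiableAt one_ne_zero).mfderiv
    simp only [mfld_simps, fderivWithin_univ] at h1
    exact h1.trans h
  obtain ⟨l, A, hA⟩ := exists_prod_continuousLinearEquiv hD
  have hF : HasStrictFDerivAt (fun y => ((f ∘ c.symm) y, l y))
      (A : EuclideanSpace ℝ (Fin 2) →L[ℝ] ℝ × ℝ) (c p) := by
    rw [hA]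
    exact (hc.hasStrictFDerivAt one_ne_zero).prodMk l.hasStrictFDerivAt
  let g := hF.toOpenPartialHomeomorph
  have hgp : c p ∈ g.source := hF.mem_toOpenPartialHomeomorph_source
  have hps : p ∈ c.source := mem_chart_source _ p
  refine ⟨c.trans g, ?_, ?_, ?_⟩
  · rw [OpenPartialHomeomorph.trans_source]
    exact ⟨hps, hgp⟩
  · intro x hx
    rw [OpenPartialHomeomorph.trans_source] at hx
    change f (c.symm (c x)) = f x
    rw [c.left_inv hx.1]
  · obtain ⟨K₁, s₁, hs₁, hL₁⟩ := hF.to_localInverse.exists_lipschitzOnWith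
    obtain ⟨K₂, s₂, hs₂, hL₂⟩ := exists_lipschitzOnWith_extChartAt_symm (𝓡 2) p
    simp only [mfld_simps] at hs₂ hL₂
    have hcont : ContinuousAt g.symm (g (c p)) := g.symm.continuousAt (g.map_source hgp)
    have hpre : g.symm ⁻¹' s₂ ∈ 𝓝 (g (c p)) := by
      refine hcont.preimage_mem_nhds ?_
      rw [g.left_inv hgp]
      exact hs₂
    refine ⟨K₂ * K₁, s₁ ∩ g.symm ⁻¹' s₂, inter_mem hs₁ hpre, ?_⟩
    exact hL₂.comp (hL₁.mono inter_subset_left) fun y hy => hy.2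

end

end MetricFunction

namespace MetricFunction

open Set Filter Topology Metric
open scoped NNReal ENNReal

theorem exists_nhds_mem_connectedComponentIn {X : Type*} [TopologicalSpace X] {f : X → ℝ} {p : X}
    (e : OpenPartialHomeomorph X (ℝ × ℝ)) (hp : p ∈ e.source)
    (he : ∀ x ∈ e.source, (e x).1 = f x) :
    ∃ U ∈ 𝓝 p, ∀ x ∈ U, ∀ y ∈ U, f x = f y → y ∈ connectedComponentIn (f ⁻¹' {f x}) x := by
  obtain ⟨r, hr, hball⟩ := Metric.mem_nhds_iff.1 (e.open_target.mem_nhds (e.map_source hp))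
  refine ⟨e.source ∩ e ⁻¹' ball (e p) r, (e.isOpen_inter_preimage isOpen_ball).mem_nhds
    ⟨hp, mem_ball_self hr⟩, ?_⟩
  rintro x ⟨hxs, hx⟩ y ⟨hys, hy⟩ hxy
  let J : Set (ℝ × ℝ) := {f x} ×ˢ ball (e p).2 r
  have hb : ∀ z ∈ ball (e p) r, z.1 ∈ ball (e p).1 r ∧ z.2 ∈ ball (e p).2 r := fun z hz =>
    ⟨(le_max_left _ _).trans_lt (mem_ball.1 hz), (le_max_right _ _).trans_lt (mem_ball.1 hz)⟩
  have hfx : f x ∈ ball (e p).1 r := by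
    rw [← he x hxs]
    exact (hb _ hx).1
  have hJ : J ⊆ ball (e p) r := by
    rw [← ball_prod_same]
    exact prod_mono (singleton_subset_iff.2 hfx) subset_rfl
  have hmem : ∀ z ∈ e.source, e z ∈ ball (e p) r → f x = f z → z ∈ e.symm '' J := by
    intro z hz hzb hxz
    refine ⟨e z, ⟨?_, (hb _ hzb).2⟩, e.left_inv hz⟩
    rw [mem_singleton_iff, he z hz, hxz]
  refine IsPreconnected.subset_connectedComponentIn (s := e.symm '' J) ?_ (hmem x hxs hx rfl) ?_
    (hmem y hys hy hxy)
  · refine IsPreconnected.image ?_ _ (e.continuousOn_symm.mono (hJ.trans hball))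
    exact isPreconnected_singleton.prod (convex_ball _ _).isPreconnected
  · rintro _ ⟨z, hz, rfl⟩
    have hzt := hball (hJ hz)
    rw [mem_preimage, mem_singleton_iff, ← he _ (e.map_target hzt), e.right_inv hzt]
    exact hz.1

section

variable {M : Type*} [EMetricSpace M] [ChartedSpace (EuclideanSpace ℝ (Fin 2)) M]
  [Bundle.RiemannianBundle (fun x : M ↦ TangentSpace (𝓡 2) x)]
  {f : M → ℝ} {φ : M → ℝ → M}

theorem hasDerivAt_comp_flow (hf : IsMetricFunction (𝓡 2) f)
    (hcrit : ∀ x : M, ¬ IsCriticalPoint (𝓡 2) f x) (hφ : IsUnitSpeedFlow (unitGrad (𝓡 2) f) φ)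
    (x : M) (t : ℝ) : HasDerivAt (fun s => f (φ x s)) ‖grad (𝓡 2) f (φ x t)‖ t := by
  have h1 : HasMFDerivAt (𝓡 2) 𝓘(ℝ, ℝ) f (φ x t) (differential (𝓡 2) f (φ x t)) :=
    ((hf.contMDiff (φ x t)).mdifferentiableAt (by norm_num)).hasMFDerivAt
  have h2 : HasFDerivAt (f ∘ φ x) ((differential (𝓡 2) f (φ x t)).comp
      ((1 : ℝ →L[ℝ] ℝ).smulRight (unitGrad (𝓡 2) f (φ x t))) : ℝ →L[ℝ] ℝ) t :=
    (h1.comp t (hφ.isMIntegralCurve x t)).hasFDerivAt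
  refine h2.hasDerivAt.congr_deriv ?_
  rw [← differential_unitGrad (hcrit (φ x t))]
  change differential (𝓡 2) f (φ x t) ((1 : ℝ) • unitGrad (𝓡 2) f (φ x t)) = _
  rw [one_smul]

theorem strictMono_comp_flow (hf : IsMetricFunction (𝓡 2) f)
    (hcrit : ∀ x : M, ¬ IsCriticalPoint (𝓡 2) f x) (hφ : IsUnitSpeedFlow (unitGrad (𝓡 2) f) φ)
    (x : M) : StrictMono fun s => f (φ x s) :=
  strictMono_of_hasDerivAt_pos (fun t => hasDerivAt_comp_flow hf hcrit hφ x t)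
    fun t => norm_grad_pos (hcrit (φ x t))

variable [IsManifold (𝓡 2) ∞ M] [IsRiemannianManifold (𝓡 2) M]
  [IsContMDiffRiemannianBundle (𝓡 2) ∞ (EuclideanSpace ℝ (Fin 2))
    (fun x : M ↦ TangentSpace (𝓡 2) x)]

theorem exists_chart_fst_eq_of_isContMDiffRiemannianBundle {p : M} (hf : ContMDiffAt (𝓡 2) 𝓘(ℝ, ℝ) 1 f p)
    (hp : ¬ IsCriticalPoint (𝓡 2) f p) :
    ∃ e : OpenPartialHomeomorph M (ℝ × ℝ), p ∈ e.source ∧ (∀ x ∈ e.source, (e x).1 = f x) ∧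
      ∃ K : ℝ≥0, ∃ s ∈ 𝓝 (e p), LipschitzOnWith K e.symm s := by
  have : IsManifold (𝓡 2) 1 M := .of_le (n := ∞) (by norm_cast)
  have : IsContinuousRiemannianBundle (EuclideanSpace ℝ (Fin 2))
      (fun x : M ↦ TangentSpace (𝓡 2) x) := by
    obtain ⟨g, hg, hg'⟩ := IsContMDiffRiemannianBundle.exists_contMDiff (IB := 𝓡 2) (n := ∞)
      (F := EuclideanSpace ℝ (Fin 2)) (E := fun x : M ↦ TangentSpace (𝓡 2) x)
    exact ⟨g, hg.continuous, hg'⟩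
  exact exists_chart_fst_eq hf hp

/-- Near every point a metric function without critical points can be reparametrized so that it
grows at unit rate along the unit gradient flow. -/
theorem exists_unit_rate_reparametrization (hf : IsMetricFunction (𝓡 2) f)
    (hcrit : ∀ x : M, ¬ IsCriticalPoint (𝓡 2) f x) (hφ : IsUnitSpeedFlow (unitGrad (𝓡 2) f) φ)
    (p : M) : ∃ (r : ℝ → ℝ) (V : Set M), ∃ δ > 0, p ∈ V ∧ ContinuousAt (r ∘ f) p ∧
      (∀ y ∈ V, ∀ z ∈ V, r (f y) = r (f z) → f y = f z) ∧
      (∀ y ∈ V, ∀ z ∈ V, f y = f z → z ∈ connectedComponentIn (f ⁻¹' {f y}) y) ∧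
      ∀ y ∈ eball p (ENNReal.ofReal δ), ∀ s ∈ Ioo (-δ) δ,
        φ y s ∈ V ∧ r (f (φ y s)) = r (f y) + s := by
  have hf1 : ContMDiff (𝓡 2) 𝓘(ℝ, ℝ) 1 f := hf.contMDiff.of_le (by norm_num)
  obtain ⟨e, hpe, he, -⟩ := exists_chart_fst_eq_of_isContMDiffRiemannianBundle (hf1 p) (hcrit p)
  obtain ⟨W, hW, hWc⟩ := exists_nhds_mem_connectedComponentIn e hpe he
  have hder := hasDerivAt_comp_flow hf hcrit hφ
  have hφc : ∀ x, Continuous (φ x) := fun x => (hφ.isMIntegralCurve x).continuous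
  have hcont : Continuous fun x => ‖grad (𝓡 2) f x‖ :=
    (contMDiff_norm_grad hf.contMDiff hcrit).continuous
  have hstrict : HasStrictDerivAt (fun t => f (φ p t)) ‖grad (𝓡 2) f (φ p 0)‖ 0 :=
    hasStrictDerivAt_of_hasDerivAt_of_continuousAt (Eventually.of_forall (hder p))
      (hcont.comp (hφc p)).continuousAt
  have hequiv := hstrict.hasStrictFDerivAt_equiv (norm_grad_pos (hcrit (φ p 0))).ne'
  let g := hequiv.toOpenPartialHomeomorph
  have hg : ∀ t, g t = f (φ p t) := fun t => rfl
  have h0 : (0 : ℝ) ∈ g.source := hequiv.mem_toOpenPartialHomeomorph_source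
  have hg0 : g 0 = f p := by rw [hg, hφ.zero]
  have hfp : f p ∈ g.target := hg0 ▸ g.map_source h0
  have hr0 : g.symm (f p) = 0 := by rw [← hg0, g.left_inv h0]
  have hrc : ContinuousAt (g.symm ∘ f) p :=
    (g.symm.continuousAt hfp).comp hf1.continuous.continuousAt
  have hV : ∀ᶠ z in 𝓝 p, z ∈ W ∧ f z ∈ g.target ∧ φ p (g.symm (f z)) ∈ W := by
    have hW' : ∀ᶠ z in 𝓝 p, z ∈ W := hW
    refine hW'.and ((hf1.continuous.continuousAt.eventually_mem
      (g.open_target.mem_nhds hfp)).and ?_)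
    have hc : ContinuousAt (fun z => φ p (g.symm (f z))) p := (hφc p).continuousAt.comp hrc
    refine hc.eventually_mem ?_
    rw [hr0, hφ.zero]
    exact hW
  obtain ⟨ε, hε, hball⟩ := EMetric.mem_nhds_iff.1 hV
  obtain ⟨δ, hδ, hδε⟩ : ∃ δ : ℝ, 0 < δ ∧ ENNReal.ofReal δ + ENNReal.ofReal δ ≤ ε := by
    obtain ⟨δ, hδ, hδε⟩ := ENNReal.lt_iff_exists_nnreal_btwn.1 (ENNReal.half_pos hε.ne')
    refine ⟨δ, by exact_mod_cast hδ, ?_⟩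
    rw [ENNReal.ofReal_coe_nnreal, ← ENNReal.add_halves ε]
    exact add_le_add hδε.le hδε.le
  have hmem : ∀ y ∈ eball p (ENNReal.ofReal δ), ∀ s ∈ Ioo (-δ) δ, φ y s ∈ eball p ε := by
    intro y hy s hs
    refine lt_of_lt_of_le ?_ hδε
    calc edist (φ y s) p ≤ edist (φ y s) (φ y 0) + edist y p := by
          conv_rhs => rw [← hφ.zero y, hφ.zero y]
          simpa only [hφ.zero] using edist_triangle (φ y s) y p
      _ < _ := by
          refine ENNReal.add_lt_add ((hφ.edist_le y s 0).trans_lt ?_) hy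
          rw [edist_dist, ENNReal.ofReal_lt_ofReal_iff hδ, Real.dist_eq, sub_zero]
          exact abs_lt.2 hs
  have hrate : ∀ y t, φ y t ∈ eball p ε → HasDerivAt (fun s => g.symm (f (φ y s))) 1 t := by
    intro y t hyt
    obtain ⟨h1, h2, h3⟩ := hball hyt
    have hgr : f (φ p (g.symm (f (φ y t)))) = f (φ y t) := g.right_inv h2
    have hnorm : ‖grad (𝓡 2) f (φ y t)‖ = ‖grad (𝓡 2) f (φ p (g.symm (f (φ y t))))‖ :=
      hf.norm_grad_eq _ _ (hWc _ h3 _ h1 hgr)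
    have hpos := norm_grad_pos (hcrit (φ y t))
    have h4 : HasDerivAt g.symm (‖grad (𝓡 2) f (φ y t)‖)⁻¹ (f (φ y t)) := by
      refine g.hasDerivAt_symm h2 hpos.ne' ?_
      rw [hnorm]
      exact hder p _
    have := h4.comp t (hder y t)
    rwa [inv_mul_cancel₀ hpos.ne'] at this
  refine ⟨g.symm, eball p ε, δ, hδ, mem_eball_self hε, hrc, ?_, ?_, ?_⟩
  · intro y hy z hz hyz
    rw [← g.right_inv (hball hy).2.1, hyz, g.right_inv (hball hz).2.1]
  · exact fun y hy z hz hyz => hWc y (hball hy).1 z (hball hz).1 hyz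
  · intro y hy s hs
    refine ⟨hmem y hy s hs, ?_⟩
    have hd : ∀ t ∈ Ioo (-δ) δ, HasDerivAt (fun t => g.symm (f (φ y t)) - t) 0 t := by
      intro t ht
      have := (hrate y t (hmem y hy t ht)).sub (hasDerivAt_id t)
      rwa [sub_self] at this
    have := isOpen_Ioo.is_const_of_deriv_eq_zero (isPreconnected_Ioo (a := -δ) (b := δ))
      (fun t ht => (hd t ht).differentiableAt.differentiableWithinAt)
      (fun t ht => (hd t ht).deriv) hs (show (0 : ℝ) ∈ Ioo (-δ) δ from ⟨by linarith, hδ⟩)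
    simp only [hφ.zero] at this
    linarith

end

end MetricFunction

namespace MetricFunction

open Set Filter Topology Metric
open scoped NNReal ENNReal

section LevelSets

variable {M : Type*} [EMetricSpace M] [ChartedSpace (EuclideanSpace ℝ (Fin 2)) M]
  [Bundle.RiemannianBundle (fun x : M ↦ TangentSpace (𝓡 2) x)]
  {f : M → ℝ} {φ : M → ℝ → M}
  [IsManifold (𝓡 2) ∞ M] [IsRiemannianManifold (𝓡 2) M]
  [IsContMDiffRiemannianBundle (𝓡 2) ∞ (EuclideanSpace ℝ (Fin 2))
    (fun x : M ↦ TangentSpace (𝓡 2) x)]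

/-- Nearby points of the same level stay on the same level along the flow. -/
theorem eventually_comp_flow_eq (hf : IsMetricFunction (𝓡 2) f)
    (hcrit : ∀ x : M, ¬ IsCriticalPoint (𝓡 2) f x) (hφ : IsUnitSpeedFlow (unitGrad (𝓡 2) f) φ)
    (x : M) (t : ℝ) : ∀ᶠ y in 𝓝 x, f y = f x → f (φ y t) = f (φ x t) := by
  refine isPreconnected_univ.induction₂
    (fun s t => (∀ᶠ y in 𝓝 x, f y = f x → f (φ y s) = f (φ x s)) ↔
      ∀ᶠ y in 𝓝 x, f y = f x → f (φ y t) = f (φ x t))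
    (fun s _ => ?_) (fun _ _ _ _ _ _ h1 h2 => h1.trans h2) (fun _ _ _ _ h => h.symm)
    (mem_univ (0 : ℝ)) (mem_univ t) |>.1
    (by simp only [hφ.zero]; exact Eventually.of_forall fun _ h => h)
  rw [nhdsWithin_univ]
  obtain ⟨r, V, δ, hδ, -, -, hV, -, hflow⟩ :=
    exists_unit_rate_reparametrization hf hcrit hφ (φ x s)
  have hloc : ∀ y ∈ eball (φ x s) (ENNReal.ofReal δ), ∀ z ∈ eball (φ x s) (ENNReal.ofReal δ),
      f y = f z → ∀ τ ∈ Ioo (-δ) δ, f (φ y τ) = f (φ z τ) := by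
    intro y hy z hz hyz τ hτ
    obtain ⟨h1, h2⟩ := hflow y hy τ hτ
    obtain ⟨h3, h4⟩ := hflow z hz τ hτ
    exact hV _ h1 _ h3 (by rw [h2, h4, hyz])
  have hstep : ∀ a b, φ x a ∈ eball (φ x s) (ENNReal.ofReal δ) → b - a ∈ Ioo (-δ) δ →
      (∀ᶠ y in 𝓝 x, f y = f x → f (φ y a) = f (φ x a)) →
      ∀ᶠ y in 𝓝 x, f y = f x → f (φ y b) = f (φ x b) := by
    intro a b ha hab h
    filter_upwards [h, (hφ.continuous a).continuousAt.eventually_mem (isOpen_eball.mem_nhds ha)]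
      with y hy hy' hyx
    have := hloc _ hy' _ ha (hy hyx) _ hab
    rwa [hφ.add, hφ.add, add_sub_cancel] at this
  filter_upwards [(hφ.isMIntegralCurve x).continuous.continuousAt.eventually_mem
    (eball_mem_nhds (φ x s) (ENNReal.ofReal_pos.2 hδ)),
    Ioo_mem_nhds (show s - δ < s by linarith) (show s < s + δ by linarith)] with t ht ht'
  exact ⟨hstep s t (mem_eball_self (ENNReal.ofReal_pos.2 hδ))
      ⟨by linarith [ht'.1], by linarith [ht'.2]⟩,
    hstep t s ht ⟨by linarith [ht'.2], by linarith [ht'.1]⟩⟩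

theorem comp_flow_eq_of_mem_connectedComponentIn (hf : IsMetricFunction (𝓡 2) f)
    (hcrit : ∀ x : M, ¬ IsCriticalPoint (𝓡 2) f x) (hφ : IsUnitSpeedFlow (unitGrad (𝓡 2) f) φ)
    {x y : M} (hy : y ∈ connectedComponentIn (f ⁻¹' {f x}) x) (t : ℝ) :
    f (φ y t) = f (φ x t) := by
  have hx : x ∈ connectedComponentIn (f ⁻¹' {f x}) x := mem_connectedComponentIn rfl
  have hsub := connectedComponentIn_subset (f ⁻¹' {f x}) x
  refine isPreconnected_connectedComponentIn.induction₂ (fun y z => f (φ y t) = f (φ z t))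
    (fun z hz => ?_) (fun _ _ _ _ _ _ h1 h2 => h1.trans h2) (fun _ _ _ _ h => h.symm) hy hx
  filter_upwards [mem_nhdsWithin_of_mem_nhds (eventually_comp_flow_eq hf hcrit hφ z t),
    self_mem_nhdsWithin] with w hw hw'
  exact (hw ((hsub hw').trans (hsub hz).symm)).symm

theorem flow_mem_connectedComponentIn (hf : IsMetricFunction (𝓡 2) f)
    (hcrit : ∀ x : M, ¬ IsCriticalPoint (𝓡 2) f x) (hφ : IsUnitSpeedFlow (unitGrad (𝓡 2) f) φ)
    {x y : M} (hy : y ∈ connectedComponentIn (f ⁻¹' {f x}) x) (t : ℝ) :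
    φ y t ∈ connectedComponentIn (f ⁻¹' {f (φ x t)}) (φ x t) := by
  have hx : x ∈ connectedComponentIn (f ⁻¹' {f x}) x := mem_connectedComponentIn rfl
  refine IsPreconnected.subset_connectedComponentIn
    (isPreconnected_connectedComponentIn.image _ (hφ.continuous t).continuousOn)
    (mem_image_of_mem _ hx) ?_ (mem_image_of_mem _ hy)
  rintro _ ⟨z, hz, rfl⟩
  exact comp_flow_eq_of_mem_connectedComponentIn hf hcrit hφ hz t

theorem exists_flow_mem_connectedComponentIn [PreconnectedSpace M]
    (hf : IsMetricFunction (𝓡 2) f)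
    (hcrit : ∀ x : M, ¬ IsCriticalPoint (𝓡 2) f x) (hφ : IsUnitSpeedFlow (unitGrad (𝓡 2) f) φ)
    (x y : M) : ∃ t, φ x t ∈ connectedComponentIn (f ⁻¹' {f y}) y := by
  have heq : ∀ a b : M, a ∈ connectedComponentIn (f ⁻¹' {f b}) b →
      connectedComponentIn (f ⁻¹' {f a}) a = connectedComponentIn (f ⁻¹' {f b}) b := by
    intro a b h
    have : f a = f b := connectedComponentIn_subset (f ⁻¹' {f b}) b h
    rw [this]
    exact (connectedComponentIn_eq h).symm
  have hself : ∀ a : M, a ∈ connectedComponentIn (f ⁻¹' {f a}) a :=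
    fun a => mem_connectedComponentIn rfl
  have hsymm : ∀ a b : M, (∃ t, φ a t ∈ connectedComponentIn (f ⁻¹' {f b}) b) →
      ∃ t, φ b t ∈ connectedComponentIn (f ⁻¹' {f a}) a := by
    rintro a b ⟨t, ht⟩
    have h1 : b ∈ connectedComponentIn (f ⁻¹' {f (φ a t)}) (φ a t) := by
      rw [heq _ _ ht]
      exact hself b
    have h2 := flow_mem_connectedComponentIn hf hcrit hφ h1 (-t)
    rw [hφ.add, add_neg_cancel, hφ.zero] at h2
    exact ⟨-t, h2⟩
  refine isPreconnected_univ.induction₂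
    (fun a b => ∃ t, φ a t ∈ connectedComponentIn (f ⁻¹' {f b}) b) (fun p _ => ?_)
    (fun a b c _ _ _ => ?_) (fun a b _ _ => hsymm a b) (mem_univ x) (mem_univ y)
  · rw [nhdsWithin_univ]
    obtain ⟨r, V, δ, hδ, hpV, hr, hV, hVc, hflow⟩ :=
      exists_unit_rate_reparametrization hf hcrit hφ p
    filter_upwards [hr.eventually_mem (Ioo_mem_nhds
        (show r (f p) - δ < (r ∘ f) p by simp [hδ]) (show (r ∘ f) p < r (f p) + δ by simp [hδ])),
      eball_mem_nhds p (ENNReal.ofReal_pos.2 hδ)] with y hy hy'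
    simp only [Function.comp_apply, mem_Ioo] at hy
    refine hsymm _ _ ⟨r (f p) - r (f y), ?_⟩
    obtain ⟨h1, h2⟩ := hflow y hy' (r (f p) - r (f y)) ⟨by linarith, by linarith⟩
    exact hVc _ hpV _ h1 (hV _ hpV _ h1 (by rw [h2]; ring))
  · rintro ⟨s, hs⟩ ⟨t, ht⟩
    refine ⟨s + t, ?_⟩
    have := flow_mem_connectedComponentIn hf hcrit hφ hs t
    rw [heq _ _ ht, hφ.add] at this
    exact this

theorem mem_connectedComponentIn_of_eq [PreconnectedSpace M] (hf : IsMetricFunction (𝓡 2) f)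
    (hcrit : ∀ x : M, ¬ IsCriticalPoint (𝓡 2) f x) (hφ : IsUnitSpeedFlow (unitGrad (𝓡 2) f) φ)
    {x y : M} (h : f y = f x) : y ∈ connectedComponentIn (f ⁻¹' {f x}) x := by
  obtain ⟨t, ht⟩ := exists_flow_mem_connectedComponentIn hf hcrit hφ y x
  have h1 : f (φ y t) = f x := connectedComponentIn_subset (f ⁻¹' {f x}) x ht
  have h2 : t = 0 := (strictMono_comp_flow hf hcrit hφ y).injective
    (by simp only [hφ.zero, h1, h])
  rwa [h2, hφ.zero] at ht

theorem isPreconnected_levelSet [PreconnectedSpace M] (hf : IsMetricFunction (𝓡 2) f)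
    (hcrit : ∀ x : M, ¬ IsCriticalPoint (𝓡 2) f x) (hφ : IsUnitSpeedFlow (unitGrad (𝓡 2) f) φ)
    (x : M) : IsPreconnected (f ⁻¹' {f x}) := by
  have : f ⁻¹' {f x} = connectedComponentIn (f ⁻¹' {f x}) x :=
    Subset.antisymm (fun _ hy => mem_connectedComponentIn_of_eq hf hcrit hφ hy)
      (connectedComponentIn_subset _ _)
  rw [this]
  exact isPreconnected_connectedComponentIn

theorem nonempty_homeomorph_levelSet [PreconnectedSpace M] (hf : IsMetricFunction (𝓡 2) f)
    (hcrit : ∀ x : M, ¬ IsCriticalPoint (𝓡 2) f x) (hφ : IsUnitSpeedFlow (unitGrad (𝓡 2) f) φ)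
    (x y : M) : Nonempty ((f ⁻¹' {f x} : Set M) ≃ₜ (f ⁻¹' {f y} : Set M)) := by
  obtain ⟨t, ht⟩ := exists_flow_mem_connectedComponentIn hf hcrit hφ x y
  have hxy : f (φ x t) = f y := connectedComponentIn_subset (f ⁻¹' {f y}) y ht
  have hmap : ∀ {a z : M} (s : ℝ), f z = f a → f (φ z s) = f (φ a s) := fun s h =>
    comp_flow_eq_of_mem_connectedComponentIn hf hcrit hφ
      (mem_connectedComponentIn_of_eq hf hcrit hφ h) s
  have hback : ∀ z, f z = f y → f (φ z (-t)) = f x := by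
    intro z hz
    have := hmap (-t) (hz.trans hxy.symm)
    rwa [hφ.add, add_neg_cancel, hφ.zero] at this
  exact ⟨{
    toFun := fun z => ⟨φ z t, (hmap t z.2).trans hxy⟩
    invFun := fun z => ⟨φ z (-t), hback z z.2⟩
    left_inv := fun z => Subtype.ext (by simp only [hφ.add, add_neg_cancel, hφ.zero])
    right_inv := fun z => Subtype.ext (by simp only [hφ.add, neg_add_cancel, hφ.zero])
    continuous_toFun := ((hφ.continuous t).comp continuous_subtype_val).subtype_mk _
    continuous_invFun := ((hφ.continuous (-t)).comp continuous_subtype_val).subtype_mk _ }⟩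

end LevelSets

end MetricFunction

namespace MetricFunction

open Set Filter Topology

section UnitSpeedCurves

variable {X : Type*} [TopologicalSpace X] {A : Set (OpenPartialHomeomorph X ℝ)}

/-- A set of charts with values in `ℝ` that covers the space and whose coordinate changes are
locally isometries `t ↦ ± t + c`. -/
structure IsIsometricAtlas (A : Set (OpenPartialHomeomorph X ℝ)) : Prop where
  exists_mem_source : ∀ x, ∃ e ∈ A, x ∈ e.source
  compatible : ∀ e ∈ A, ∀ e' ∈ A, ∀ x ∈ e.source, x ∈ e'.source →
    ∃ σ : ℝ, (σ = 1 ∨ σ = -1) ∧ ∀ᶠ t in 𝓝 (e x), e' (e.symm t) = e' x + σ * (t - e x)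

/-- A curve is of unit speed at `t` if in a chart of `A` it is `s ↦ ± s + c` near `t`. -/
def UnitSpeedAt (A : Set (OpenPartialHomeomorph X ℝ)) (γ : ℝ → X) (t : ℝ) : Prop :=
  ∃ e ∈ A, γ t ∈ e.source ∧ ∃ σ : ℝ, (σ = 1 ∨ σ = -1) ∧
    ∀ᶠ s in 𝓝 t, γ s = e.symm (e (γ t) + σ * (s - t))

theorem mul_self_eq_one_of_eq_one_or {σ : ℝ} (h : σ = 1 ∨ σ = -1) : σ * σ = 1 := by
  rcases h with rfl | rfl <;> norm_num

theorem mul_eq_one_or {σ τ : ℝ} (h : σ = 1 ∨ σ = -1) (h' : τ = 1 ∨ τ = -1) :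
    σ * τ = 1 ∨ σ * τ = -1 := by
  rcases h with rfl | rfl <;> rcases h' with rfl | rfl <;> norm_num

theorem UnitSpeedAt.continuousAt {γ : ℝ → X} {t : ℝ} (h : UnitSpeedAt A γ t) :
    ContinuousAt γ t := by
  obtain ⟨e, -, he, σ, -, hγ⟩ := h
  refine ContinuousAt.congr ?_ (hγ.mono fun _ h => h.symm)
  refine ContinuousAt.comp (g := e.symm) (e.symm.continuousAt ?_) (by fun_prop)
  simpa using e.map_source he

theorem UnitSpeedAt.congr {γ δ : ℝ → X} {t : ℝ} (h : UnitSpeedAt A γ t) (hδ : γ =ᶠ[𝓝 t] δ) :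
    UnitSpeedAt A δ t := by
  obtain ⟨e, heA, he, σ, hσ, hγ⟩ := h
  rw [UnitSpeedAt, ← hδ.self_of_nhds]
  exact ⟨e, heA, he, σ, hσ, by filter_upwards [hδ, hγ] with s h1 h2 using h1 ▸ h2⟩

theorem UnitSpeedAt.comp_affine {γ : ℝ → X} {a σ t : ℝ} (hσ : σ = 1 ∨ σ = -1)
    (h : UnitSpeedAt A γ (a + σ * t)) : UnitSpeedAt A (fun s => γ (a + σ * s)) t := by
  obtain ⟨e, heA, he, τ, hτ, hγ⟩ := h
  refine ⟨e, heA, he, τ * σ, mul_eq_one_or hτ hσ, ?_⟩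
  have hc : Tendsto (fun s => a + σ * s) (𝓝 t) (𝓝 (a + σ * t)) :=
    (by fun_prop : Continuous fun s => a + σ * s).tendsto t
  filter_upwards [hc.eventually hγ] with s hs
  rw [hs]
  congr 1
  ring

theorem unitSpeedAt_symm_affine {e : OpenPartialHomeomorph X ℝ} (he : e ∈ A) {c σ a t : ℝ}
    (hσ : σ = 1 ∨ σ = -1) (ht : c + σ * (t - a) ∈ e.target) :
    UnitSpeedAt A (fun s => e.symm (c + σ * (s - a))) t := by
  refine ⟨e, he, e.map_target ht, σ, hσ, Eventually.of_forall fun s => ?_⟩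
  rw [e.right_inv ht]
  ring_nf

theorem UnitSpeedAt.exists_chart_eq (hA : IsIsometricAtlas A) {γ : ℝ → X} {t : ℝ}
    (h : UnitSpeedAt A γ t) {e : OpenPartialHomeomorph X ℝ} (heA : e ∈ A) (he : γ t ∈ e.source) :
    ∃ σ : ℝ, (σ = 1 ∨ σ = -1) ∧ ∀ᶠ s in 𝓝 t, γ s ∈ e.source ∧ e (γ s) = e (γ t) + σ * (s - t) := by
  have hcont := h.continuousAt
  obtain ⟨e₀, he₀A, he₀, σ, hσ, hγ⟩ := h
  obtain ⟨τ, hτ, hcomp⟩ := hA.compatible e₀ he₀A e heA (γ t) he₀ he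
  refine ⟨τ * σ, mul_eq_one_or hτ hσ, ?_⟩
  have hc : Tendsto (fun s => e₀ (γ t) + σ * (s - t)) (𝓝 t) (𝓝 (e₀ (γ t))) := by
    have := (by fun_prop : Continuous fun s => e₀ (γ t) + σ * (s - t)).tendsto t
    simpa using this
  filter_upwards [hγ, hc.eventually hcomp,
    hcont.eventually_mem (e.open_source.mem_nhds he)] with s h1 h2 h3
  refine ⟨h3, ?_⟩
  rw [h1, h2]
  ring

theorem UnitSpeedAt.exists_injOn (hA : IsIsometricAtlas A) {γ : ℝ → X} {t : ℝ}
    (h : UnitSpeedAt A γ t) : ∃ N ∈ 𝓝 t, InjOn γ N := by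
  obtain ⟨e, heA, he⟩ := hA.exists_mem_source (γ t)
  obtain ⟨σ, hσ, hγ⟩ := h.exists_chart_eq hA heA he
  refine ⟨_, hγ, fun s hs u hu hsu => ?_⟩
  have h1 : e (γ t) + σ * (s - t) = e (γ t) + σ * (u - t) := by rw [← hs.2, ← hu.2, hsu]
  rcases hσ with rfl | rfl <;> linarith

theorem UnitSpeedAt.image_mem_nhds (hA : IsIsometricAtlas A) {γ : ℝ → X} {t : ℝ}
    (h : UnitSpeedAt A γ t) {N : Set ℝ} (hN : N ∈ 𝓝 t) : γ '' N ∈ 𝓝 (γ t) := by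
  obtain ⟨e, heA, he⟩ := hA.exists_mem_source (γ t)
  obtain ⟨σ, hσ, hγ⟩ := h.exists_chart_eq hA heA he
  have hc : Tendsto (fun x => t + σ * (e x - e (γ t))) (𝓝 (γ t)) (𝓝 t) := by
    have h1 := (e.continuousAt he).sub_const (e (γ t))
    have h2 := (h1.const_mul σ).const_add t
    simpa [ContinuousAt] using h2
  filter_upwards [hc.eventually_mem (inter_mem hN hγ), e.open_source.mem_nhds he] with x hx hxs
  refine ⟨_, hx.1, e.injOn hx.2.1 hxs ?_⟩
  rw [hx.2.2]
  linear_combination (e x - e (γ t)) * mul_self_eq_one_of_eq_one_or hσ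

theorem UnitSpeedAt.eventuallyEq_of_eq (hA : IsIsometricAtlas A) {γ : ℝ → X} {s t : ℝ}
    (hs : UnitSpeedAt A γ s) (ht : UnitSpeedAt A γ t) (hst : γ s = γ t) :
    ∃ σ : ℝ, (σ = 1 ∨ σ = -1) ∧ ∀ᶠ v in 𝓝 s, γ v = γ (t + σ * (v - s)) := by
  obtain ⟨e, heA, he⟩ := hA.exists_mem_source (γ s)
  obtain ⟨σ, hσ, h1⟩ := hs.exists_chart_eq hA heA he
  obtain ⟨τ, hτ, h2⟩ := ht.exists_chart_eq hA heA (hst ▸ he)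
  refine ⟨τ * σ, mul_eq_one_or hτ hσ, ?_⟩
  have hc : Tendsto (fun v => t + τ * σ * (v - s)) (𝓝 s) (𝓝 t) := by
    have := (by fun_prop : Continuous fun v => t + τ * σ * (v - s)).tendsto s
    simpa using this
  filter_upwards [h1, hc.eventually h2] with v hv hv'
  refine e.injOn hv.1 hv'.1 ?_
  rw [hv.2, hv'.2, hst]
  linear_combination -σ * (v - s) * mul_self_eq_one_of_eq_one_or hτ

theorem eventuallyEq_of_unitSpeedAt [T2Space X] (hA : IsIsometricAtlas A) {γ δ : ℝ → X}
    {J : Set ℝ} (hJ : IsPreconnected J) (hγ : ∀ t ∈ J, UnitSpeedAt A γ t)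
    (hδ : ∀ t ∈ J, UnitSpeedAt A δ t) {t₀ : ℝ} (ht₀ : t₀ ∈ J) (h : γ =ᶠ[𝓝 t₀] δ) :
    ∀ t ∈ J, γ =ᶠ[𝓝 t] δ := by
  refine hJ.subset_of_closure_inter_subset (u := {t | γ =ᶠ[𝓝 t] δ})
    isOpen_setOfPred_eventually_nhds ⟨t₀, ht₀, h⟩ ?_
  rintro t ⟨htc, htJ⟩
  by_contra hcon
  have hfreq : ∃ᶠ s in 𝓝 t, γ =ᶠ[𝓝 s] δ := mem_closure_iff_frequently.1 htc
  have hγδ : γ t = δ t := tendsto_nhds_unique_of_frequently_eq (hγ t htJ).continuousAt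
    (hδ t htJ).continuousAt (hfreq.mono fun s hs => hs.self_of_nhds)
  obtain ⟨e, heA, he⟩ := hA.exists_mem_source (γ t)
  obtain ⟨σ, hσ, h1⟩ := (hγ t htJ).exists_chart_eq hA heA he
  obtain ⟨τ, hτ, h2⟩ := (hδ t htJ).exists_chart_eq hA heA (hγδ ▸ he)
  obtain ⟨s, hs, hs1, hs2⟩ := (hfreq.and_eventually (h1.and h2)).exists
  have hst : s - t ≠ 0 := by
    rw [sub_ne_zero]
    rintro rfl
    exact hcon hs
  have h3 : e (γ t) + σ * (s - t) = e (γ t) + τ * (s - t) := by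
    rw [← hs1.2, hs.self_of_nhds, hs2.2, hγδ]
  have hστ : σ = τ := mul_right_cancel₀ hst (add_left_cancel h3)
  apply hcon
  filter_upwards [h1, h2] with v hv hv'
  refine e.injOn hv.1 hv'.1 ?_
  rw [hv.2, hv'.2, hγδ, hστ]

/-- A unit speed curve on an open interval that cannot be continued. -/
structure IsMaximalUnitSpeed (A : Set (OpenPartialHomeomorph X ℝ)) (γ : ℝ → X) (J : Set ℝ) :
    Prop where
  isOpen : IsOpen J
  isPreconnected : IsPreconnected J
  nonempty : J.Nonempty
  unitSpeedAt : ∀ t ∈ J, UnitSpeedAt A γ t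
  maximal : ∀ (K : Set ℝ) (δ : ℝ → X), IsOpen K → IsPreconnected K →
    (∀ t ∈ K, UnitSpeedAt A δ t) → ∀ t ∈ J, t ∈ K → γ =ᶠ[𝓝 t] δ → K ⊆ J ∧ EqOn γ δ K

theorem isPreconnected_inter_real {J K : Set ℝ} (hJ : IsPreconnected J) (hK : IsPreconnected K) :
    IsPreconnected (J ∩ K) :=
  (hJ.ordConnected.inter hK.ordConnected).isPreconnected

theorem exists_isMaximalUnitSpeed [T2Space X] [Nonempty X] (hA : IsIsometricAtlas A) :
    ∃ (γ : ℝ → X) (J : Set ℝ), IsMaximalUnitSpeed A γ J := by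
  obtain ⟨x₀⟩ := ‹Nonempty X›
  obtain ⟨e, heA, he⟩ := hA.exists_mem_source x₀
  let γ₀ : ℝ → X := fun s => e.symm (e x₀ + 1 * (s - 0))
  have h₀ : ∀ᶠ t in 𝓝 (0 : ℝ), UnitSpeedAt A γ₀ t := by
    have hc : Tendsto (fun s => e x₀ + 1 * (s - 0)) (𝓝 0) (𝓝 (e x₀)) := by
      have := (by fun_prop : Continuous fun s => e x₀ + 1 * (s - 0)).tendsto 0
      simpa using this
    filter_upwards [hc.eventually_mem (e.open_target.mem_nhds (e.map_source he))] with t ht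
    exact unitSpeedAt_symm_affine heA (Or.inl rfl) ht
  let P : Set ℝ → (ℝ → X) → Prop := fun J γ => IsOpen J ∧ IsPreconnected J ∧ (0 : ℝ) ∈ J ∧
    (∀ t ∈ J, UnitSpeedAt A γ t) ∧ γ =ᶠ[𝓝 0] γ₀
  have huniq : ∀ J γ J' γ', P J γ → P J' γ' → ∀ t ∈ J, t ∈ J' → γ t = γ' t := by
    intro J γ J' γ' h h' t ht ht'
    exact (eventuallyEq_of_unitSpeedAt hA (isPreconnected_inter_real h.2.1 h'.2.1)
      (fun s hs => h.2.2.2.1 s hs.1) (fun s hs => h'.2.2.2.1 s hs.2) ⟨h.2.2.1, h'.2.2.1⟩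
      (h.2.2.2.2.trans h'.2.2.2.2.symm) t ⟨ht, ht'⟩).self_of_nhds
  let S : Set (Set ℝ) := {J | ∃ γ, P J γ}
  have hex : ∀ t ∈ ⋃₀ S, ∃ y, ∃ J γ, P J γ ∧ t ∈ J ∧ y = γ t := by
    rintro t ⟨J, ⟨γ, hP⟩, ht⟩
    exact ⟨γ t, J, γ, hP, ht, rfl⟩
  have : Nonempty X := ⟨x₀⟩
  choose! Γ hΓ using hex
  have hΓeq : ∀ J γ, P J γ → EqOn Γ γ J := by
    intro J γ hP t ht
    obtain ⟨J', γ', hP', ht', hy⟩ := hΓ t ⟨J, ⟨γ, hP⟩, ht⟩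
    rw [hy]
    exact huniq _ _ _ _ hP' hP t ht' ht
  have hΓev : ∀ J γ, P J γ → ∀ t ∈ J, γ =ᶠ[𝓝 t] Γ := by
    intro J γ hP t ht
    filter_upwards [hP.1.mem_nhds ht] with s hs using (hΓeq J γ hP hs).symm
  obtain ⟨r, hr, hball⟩ := Metric.eventually_nhds_iff_ball.1 h₀
  have hP₀ : P (Metric.ball 0 r) γ₀ := ⟨Metric.isOpen_ball, (convex_ball _ _).isPreconnected,
    Metric.mem_ball_self hr, hball, EventuallyEq.rfl⟩
  have hPΓ : P (⋃₀ S) Γ := by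
    refine ⟨isOpen_sUnion fun J ⟨γ, hP⟩ => hP.1, isPreconnected_sUnion 0 S
      (fun J ⟨γ, hP⟩ => hP.2.2.1) (fun J ⟨γ, hP⟩ => hP.2.1),
      ⟨_, ⟨γ₀, hP₀⟩, hP₀.2.2.1⟩, ?_, (hΓev _ _ hP₀ 0 hP₀.2.2.1).symm⟩
    rintro t ⟨J, ⟨γ, hP⟩, ht⟩
    exact (hP.2.2.2.1 t ht).congr (hΓev J γ hP t ht)
  refine ⟨Γ, ⋃₀ S, hPΓ.1, hPΓ.2.1, ⟨0, hPΓ.2.2.1⟩, hPΓ.2.2.2.1, ?_⟩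
  intro K δ hKo hK hδ t htJ htK hγδ
  classical
  have hcap := eventuallyEq_of_unitSpeedAt hA (isPreconnected_inter_real hPΓ.2.1 hK)
    (fun s hs => hPΓ.2.2.2.1 s hs.1) (fun s hs => hδ s hs.2) ⟨htJ, htK⟩ hγδ
  let η : ℝ → X := (⋃₀ S).piecewise Γ δ
  have hηΓ : ∀ s ∈ ⋃₀ S, Γ =ᶠ[𝓝 s] η := by
    intro s hs
    filter_upwards [hPΓ.1.mem_nhds hs] with u hu using (piecewise_eq_of_mem _ _ _ hu).symm
  have hηδ' : EqOn δ η K := by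
    intro u hu
    by_cases huS : u ∈ ⋃₀ S
    · rw [← (hcap u ⟨huS, hu⟩).self_of_nhds]
      exact (piecewise_eq_of_mem _ _ _ huS).symm
    · exact (piecewise_eq_of_notMem _ _ _ huS).symm
  have hηδ : ∀ s ∈ K, δ =ᶠ[𝓝 s] η := by
    intro s hs
    filter_upwards [hKo.mem_nhds hs] with u hu using hηδ' hu
  have hPη : P (⋃₀ S ∪ K) η := by
    refine ⟨hPΓ.1.union hKo, hPΓ.2.1.union t htJ htK hK, Or.inl hPΓ.2.2.1, ?_,
      (hηΓ 0 hPΓ.2.2.1).symm.trans hPΓ.2.2.2.2⟩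
    rintro s (hs | hs)
    · exact (hPΓ.2.2.2.1 s hs).congr (hηΓ s hs)
    · exact (hδ s hs).congr (hηδ s hs)
  exact ⟨fun s hs => ⟨_, ⟨η, hPη⟩, Or.inr hs⟩,
    fun s hs => (hΓeq _ _ hPη (Or.inr hs)).trans (hηδ' hs).symm⟩

theorem IsMaximalUnitSpeed.image_eq_univ [PreconnectedSpace X] (hA : IsIsometricAtlas A)
    {γ : ℝ → X} {J : Set ℝ} (h : IsMaximalUnitSpeed A γ J) : γ '' J = univ := by
  refine IsClopen.eq_univ ⟨?_, ?_⟩ (h.nonempty.image γ)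
  · refine isClosed_of_closure_subset fun q hq => ?_
    obtain ⟨e, heA, he⟩ := hA.exists_mem_source q
    obtain ⟨r, hr, hball⟩ := Metric.mem_nhds_iff.1 (e.open_target.mem_nhds (e.map_source he))
    have hW : e.source ∩ e ⁻¹' Metric.ball (e q) r ∈ 𝓝 q :=
      (e.isOpen_inter_preimage Metric.isOpen_ball).mem_nhds ⟨he, Metric.mem_ball_self hr⟩
    obtain ⟨_, ⟨hts, htb⟩, t, ht, rfl⟩ := mem_closure_iff_nhds.1 hq _ hW
    obtain ⟨σ, hσ, hγ⟩ := (h.unitSpeedAt t ht).exists_chart_eq hA heA hts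
    have hσσ := mul_self_eq_one_of_eq_one_or hσ
    let K : Set ℝ := Metric.ball (t + σ * (e q - e (γ t))) r
    have hK : ∀ s ∈ K, e (γ t) + σ * (s - t) ∈ Metric.ball (e q) r := by
      intro s hs
      simp only [K, Metric.mem_ball, Real.dist_eq] at hs ⊢
      rcases hσ with rfl | rfl
      · convert! hs using 2
        ring
      · rw [← abs_neg]
        convert! hs using 2
        ring
    have htK : t ∈ K := by
      simp only [K, mem_preimage, Metric.mem_ball, Real.dist_eq] at htb ⊢
      rcases hσ with rfl | rfl
      · convert! htb using 2
        ring
      · rw [← abs_neg]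
        convert! htb using 2
        ring
    obtain ⟨hKJ, heq⟩ := h.maximal K (fun s => e.symm (e (γ t) + σ * (s - t))) Metric.isOpen_ball
      (convex_ball _ _).isPreconnected
      (fun s hs => unitSpeedAt_symm_affine heA hσ (hball (hK s hs))) t ht htK
      (hγ.mono fun s hs => by
        change γ s = e.symm (e (γ t) + σ * (s - t))
        rw [← hs.2, e.left_inv hs.1])
    have hc : t + σ * (e q - e (γ t)) ∈ K := Metric.mem_ball_self hr
    refine ⟨_, hKJ hc, ?_⟩
    rw [heq hc]
    have : e (γ t) + σ * (t + σ * (e q - e (γ t)) - t) = e q := by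
      linear_combination (e q - e (γ t)) * hσσ
    simp only [this, e.left_inv he]
  · rw [isOpen_iff_mem_nhds]
    rintro _ ⟨t, ht, rfl⟩
    exact (h.unitSpeedAt t ht).image_mem_nhds hA (h.isOpen.mem_nhds ht)

end UnitSpeedCurves

end MetricFunction

namespace MetricFunction

open Set Filter Topology

theorem nonempty_homeomorph_real_of_isOpen {J : Set ℝ} (hJo : IsOpen J) (hJ : IsPreconnected J)
    (hne : J.Nonempty) : Nonempty (J ≃ₜ ℝ) := by
  have hemb : IsOpenEmbedding Real.arctan := by
    refine ⟨Real.arctan_strictMono.isEmbedding_of_ordConnected ?_, ?_⟩ <;>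
      rw [Real.range_arctan]
    · exact ordConnected_Ioo
    · exact isOpen_Ioo
  have ho : IsOpen (Real.arctan '' J) := hemb.isOpenMap J hJo
  have hc : Convex ℝ (Real.arctan '' J) :=
    ((hJ.image _ hemb.continuous.continuousOn).ordConnected).convex
  have hb : Bornology.IsBounded (Real.arctan '' J) := by
    refine (Metric.isBounded_Ioo (-(Real.pi / 2)) (Real.pi / 2)).subset ?_
    rw [← Real.range_arctan]
    exact image_subset_range _ _
  obtain ⟨h, hh, -⟩ := exists_homeomorph_image_interior_closure_frontier_eq_unitBall hc
    (by rw [ho.interior_eq]; exact hne.image _) hb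
  rw [ho.interior_eq] at hh
  exact ⟨((hemb.isEmbedding.homeomorphImage J).trans (h.image _)).trans
    ((Homeomorph.setCongr hh).trans Homeomorph.unitBall.symm)⟩

section Classification

variable {X : Type*} [TopologicalSpace X] {A : Set (OpenPartialHomeomorph X ℝ)}

/-- A maximal unit speed curve that meets itself is defined everywhere and periodic. -/
theorem IsMaximalUnitSpeed.periodic_of_eq [T2Space X] (hA : IsIsometricAtlas A)
    {γ : ℝ → X} {J : Set ℝ} (h : IsMaximalUnitSpeed A γ J) {s t : ℝ} (hs : s ∈ J) (ht : t ∈ J)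
    (hst : s < t) (heq : γ s = γ t) : J = univ ∧ Function.Periodic γ (t - s) := by
  obtain ⟨σ, hσ, hev⟩ := (h.unitSpeedAt s hs).eventuallyEq_of_eq hA (h.unitSpeedAt t ht) heq
  have hJ := h.isPreconnected.ordConnected
  have hK : ∀ a σ : ℝ, (σ = 1 ∨ σ = -1) →
      IsPreconnected {v | a + σ * v ∈ J} ∧ IsOpen {v | a + σ * v ∈ J} := by
    intro a σ hσ
    refine ⟨OrdConnected.isPreconnected ?_, h.isOpen.preimage (by fun_prop)⟩
    rcases hσ with rfl | rfl
    · refine ⟨fun x hx y hy z hz => hJ.out hx hy ⟨?_, ?_⟩⟩ <;> linarith [hz.1, hz.2]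
    · refine ⟨fun x hx y hy z hz => hJ.out hy hx ⟨?_, ?_⟩⟩ <;> linarith [hz.1, hz.2]
  have hext : ∀ a σ : ℝ, (σ = 1 ∨ σ = -1) → ∀ v ∈ J, a + σ * v ∈ J →
      (∀ᶠ u in 𝓝 v, γ u = γ (a + σ * u)) →
      ∀ u, a + σ * u ∈ J → u ∈ J ∧ γ u = γ (a + σ * u) := by
    intro a σ hσ v hv hv' hev u hu
    obtain ⟨h1, h2⟩ := h.maximal {v | a + σ * v ∈ J} (fun v => γ (a + σ * v)) (hK a σ hσ).2
      (hK a σ hσ).1 (fun w hw => (h.unitSpeedAt _ hw).comp_affine hσ) v hv hv' hev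
    exact ⟨h1 hu, h2 hu⟩
  rcases hσ with rfl | rfl
  · have hright : ∀ u, (t - s) + 1 * u ∈ J → u ∈ J ∧ γ u = γ ((t - s) + 1 * u) := by
      refine hext (t - s) 1 (Or.inl rfl) s hs (by simpa using ht) ?_
      filter_upwards [hev] with v hv
      rw [hv]
      ring_nf
    have hleft : ∀ u, (s - t) + 1 * u ∈ J → u ∈ J ∧ γ u = γ ((s - t) + 1 * u) := by
      refine hext (s - t) 1 (Or.inl rfl) t ht (by simpa using hs) ?_
      have hc : Tendsto (fun u => (s - t) + 1 * u) (𝓝 t) (𝓝 s) := by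
        have := (by fun_prop : Continuous fun u => (s - t) + 1 * u).tendsto t
        simpa using this
      filter_upwards [hc.eventually hev] with v hv
      rw [hv]
      ring_nf
    have hT : 0 < t - s := sub_pos.2 hst
    have hup : ∀ n : ℕ, s + n * (t - s) ∈ J := by
      intro n
      induction n with
      | zero => simpa using hs
      | succ n ih =>
        refine (hleft _ ?_).1
        convert! ih using 1
        push_cast
        ring
    have hdown : ∀ n : ℕ, s - n * (t - s) ∈ J := by
      intro n
      induction n with
      | zero => simpa using hs
      | succ n ih =>
        refine (hright _ ?_).1
        convert! ih using 1
        push_cast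
        ring
    have hJu : J = univ := by
      refine eq_univ_of_forall fun u => ?_
      obtain ⟨n, hn⟩ := exists_nat_gt (|u - s| / (t - s))
      rw [div_lt_iff₀ hT, abs_lt] at hn
      exact hJ.out (hdown n) (hup n) ⟨by linarith [hn.1], by linarith [hn.2]⟩
    refine ⟨hJu, fun u => ?_⟩
    rw [(hright u (hJu ▸ mem_univ _)).2]
    ring_nf
  · exfalso
    have hsJ : (s + t) + (-1) * s ∈ J := by
      convert! ht using 1
      ring
    have htJ : (s + t) + (-1) * t ∈ J := by
      convert! hs using 1
      ring
    have hrefl := hext (s + t) (-1) (Or.inr rfl) s hs hsJ (by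
      filter_upwards [hev] with v hv
      rw [hv]
      ring_nf)
    have hm : (s + t) / 2 ∈ J := hJ.out hs ht ⟨by linarith, by linarith⟩
    obtain ⟨N, hN, hinj⟩ := (h.unitSpeedAt _ hm).exists_injOn hA
    have hc : Tendsto (fun u => (s + t) + (-1) * u) (𝓝 ((s + t) / 2)) (𝓝 ((s + t) / 2)) := by
      have := (by fun_prop : Continuous fun u => (s + t) + (-1) * u).tendsto ((s + t) / 2)
      convert! this using 2
      ring
    obtain ⟨r, hr, hball⟩ := Metric.eventually_nhds_iff_ball.1
      ((eventually_mem_set.2 hN).and (hc.eventually_mem (inter_mem hN (h.isOpen.mem_nhds hm))))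
    obtain ⟨h1, h2, h3⟩ := hball ((s + t) / 2 + r / 2) (by
      rw [Metric.mem_ball, Real.dist_eq, abs_of_pos (by linarith)]
      linarith)
    have := hinj h1 h2 (hrefl _ h3).2
    linarith

theorem nonempty_homeomorph_circle_of_periodic [T2Space X] {γ : ℝ → X} (hγ : Continuous γ)
    (hsurj : Function.Surjective γ) {N : Set ℝ} (hN : N ∈ 𝓝 (0 : ℝ)) (hinj : InjOn γ N)
    (hper : ∀ s t, γ s = γ t → Function.Periodic γ (t - s)) {T : ℝ} (hT : T ≠ 0)
    (hγT : Function.Periodic γ T) : Nonempty (X ≃ₜ Circle) := by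
  let P : AddSubgroup ℝ :=
    { carrier := {T | Function.Periodic γ T}
      add_mem' := fun h h' => h.add_period h'
      zero_mem' := fun x => by rw [add_zero]
      neg_mem' := fun h => h.neg }
  have hmem : ∀ {T}, T ∈ P ↔ Function.Periodic γ T := Iff.rfl
  rcases P.dense_or_cyclic with hd | ⟨a, ha⟩
  · exfalso
    obtain ⟨r, hr, hball⟩ := Metric.mem_nhds_iff.1 hN
    obtain ⟨T, hT, hTP⟩ := hd.exists_mem_open (isOpen_Ioo (a := 0) (b := r)) (nonempty_Ioo.2 hr)
    have h1 : γ T = γ 0 := by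
      have := hmem.1 hT 0
      rwa [zero_add] at this
    have := hinj (hball (by rw [Metric.mem_ball, Real.dist_eq, sub_zero, abs_of_pos hTP.1]
                            exact hTP.2)) (hball (Metric.mem_ball_self hr)) h1
    exact hTP.1.ne' this
  · rw [← AddSubgroup.zmultiples_eq_closure] at ha
    obtain ⟨b, hb, hPb⟩ : ∃ b : ℝ, 0 < b ∧ P = AddSubgroup.zmultiples b := by
      rcases lt_trichotomy a 0 with h | h | h
      · exact ⟨-a, neg_pos.2 h, by rw [ha, AddSubgroup.zmultiples_neg]⟩
      · exfalso
        have : T ∈ P := hmem.2 hγT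
        rw [ha, h, AddSubgroup.zmultiples_zero_eq_bot, AddSubgroup.mem_bot] at this
        exact hT this
      · exact ⟨a, h, ha⟩
    have : Fact (0 < b) := ⟨hb⟩
    have hγb : Function.Periodic γ b := by
      rw [← hmem, hPb]
      exact AddSubgroup.mem_zmultiples b
    let g : AddCircle b → X := hγb.lift
    have hg : ∀ t : ℝ, g t = γ t := fun t => rfl
    have hgc : Continuous g := continuous_coinduced_dom.2 hγ
    have hgb : Function.Bijective g := by
      refine ⟨fun x y hxy => ?_, fun x => ?_⟩
      · induction x using QuotientAddGroup.induction_on with | H s => ?_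
        induction y using QuotientAddGroup.induction_on with | H t => ?_
        have : t - s ∈ P := hper s t hxy
        rw [hPb] at this
        rw [eq_comm]
        exact (QuotientAddGroup.eq_iff_sub_mem).2 this
      · obtain ⟨t, rfl⟩ := hsurj x
        exact ⟨t, hg t⟩
    exact ⟨(Continuous.homeoOfEquivCompactToT2 (f := Equiv.ofBijective g hgb) hgc).symm.trans
      (AddCircle.homeomorphCircle hb.ne')⟩

/-- A connected Hausdorff space with an isometric atlas of dimension one is a circle or a line. -/
theorem IsIsometricAtlas.nonempty_homeomorph [T2Space X] [ConnectedSpace X]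
    (hA : IsIsometricAtlas A) : Nonempty (X ≃ₜ Circle) ∨ Nonempty (X ≃ₜ ℝ) := by
  obtain ⟨γ, J, h⟩ := exists_isMaximalUnitSpeed hA
  have himg := h.image_eq_univ hA
  by_cases hinj : InjOn γ J
  · right
    obtain ⟨φ⟩ := nonempty_homeomorph_real_of_isOpen h.isOpen h.isPreconnected h.nonempty
    have hb : Function.Bijective (J.domRestrict γ) := by
      refine ⟨injOn_iff_injective.1 hinj, ?_⟩
      rw [← range_eq_univ, range_domRestrict, himg]
    have hc : Continuous (J.domRestrict γ) := by
      rw [← continuousOn_iff_continuous_domRestrict]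
      exact fun t ht => (h.unitSpeedAt t ht).continuousAt.continuousWithinAt
    have ho : IsOpenMap (J.domRestrict γ) := by
      rw [isOpenMap_iff_nhds_le]
      intro t
      refine le_map fun s hs => ?_
      have h1 : (↑) '' s ∈ 𝓝 (t : ℝ) := h.isOpen.isOpenEmbedding_subtypeVal.image_mem_nhds.2 hs
      have h2 := (h.unitSpeedAt t t.2).image_mem_nhds hA h1
      rwa [image_image] at h2
    exact ⟨(Equiv.toHomeomorphOfContinuousOpen (Equiv.ofBijective _ hb) hc ho).symm.trans φ⟩
  · left
    rw [InjOn] at hinj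
    push Not at hinj
    obtain ⟨s, hs, t, ht, hst, hne⟩ := hinj
    obtain ⟨T, hT, hJ, hγT⟩ : ∃ T : ℝ, T ≠ 0 ∧ J = univ ∧ Function.Periodic γ T := by
      rcases lt_or_gt_of_ne hne with h' | h'
      · exact ⟨t - s, sub_ne_zero.2 hne.symm, h.periodic_of_eq hA hs ht h' hst⟩
      · exact ⟨s - t, sub_ne_zero.2 hne, h.periodic_of_eq hA ht hs h' hst.symm⟩
    subst hJ
    obtain ⟨N, hN, hNinj⟩ := (h.unitSpeedAt 0 (mem_univ _)).exists_injOn hA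
    refine nonempty_homeomorph_circle_of_periodic
      (continuous_iff_continuousAt.2 fun t => (h.unitSpeedAt t (mem_univ _)).continuousAt)
      (fun x => ?_) hN hNinj (fun s t hst => ?_) hT hγT
    · obtain ⟨t, -, ht⟩ := himg.symm ▸ mem_univ x
      exact ⟨t, ht⟩
    · rcases lt_trichotomy s t with h' | rfl | h'
      · exact (h.periodic_of_eq hA (mem_univ _) (mem_univ _) h' hst).2
      · intro x
        rw [sub_self, add_zero]
      · have := (h.periodic_of_eq hA (mem_univ _) (mem_univ _) h' hst.symm).2.neg
        rwa [neg_sub] at this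

end Classification

end MetricFunction

namespace MetricFunction

open Set Filter Topology MeasureTheory
open scoped NNReal ENNReal MeasureTheory

section ArcLength

variable {X : Type*} [EMetricSpace X] [MeasurableSpace X] [BorelSpace X]

theorem hausdorffMeasure_pos_of_isPreconnected {S : Set X} (hS : IsPreconnected S) {p q : X}
    (hp : p ∈ S) (hq : q ∈ S) (hpq : p ≠ q) (hfin : ∀ x ∈ S, edist x p ≠ ⊤) : 0 < μH[1] S := by
  have hlip : LipschitzOnWith 1 (fun x => (edist x p).toReal) S := by
    intro x hx y hy
    rw [ENNReal.coe_one, one_mul, edist_dist, Real.dist_eq]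
    rcases eq_or_ne (edist x y) ⊤ with h | h
    · rw [h]
      exact le_top
    refine ENNReal.ofReal_le_of_le_toReal ?_
    have key : ∀ {x y : X}, y ∈ S → edist x y ≠ ⊤ →
        (edist x p).toReal ≤ (edist x y).toReal + (edist y p).toReal := by
      intro x y hy h
      rw [← ENNReal.toReal_add h (hfin y hy)]
      exact ENNReal.toReal_mono (ENNReal.add_ne_top.2 ⟨h, hfin y hy⟩) (edist_triangle _ _ _)
    have h1 := key hy h
    have h2 := key hx (edist_comm x y ▸ h)
    rw [edist_comm y x] at h2
    rw [abs_le]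
    constructor <;> linarith
  have hle := hlip.hausdorffMeasure_image_le (d := 1) zero_le_one
  rw [ENNReal.coe_one, ENNReal.one_rpow, one_mul, hausdorffMeasure_real] at hle
  refine lt_of_lt_of_le ?_ hle
  have hq' : 0 < (edist q p).toReal :=
    ENNReal.toReal_pos (edist_pos.2 hpq.symm).ne' (hfin q hq)
  have hsub : Icc 0 (edist q p).toReal ⊆ (fun x => (edist x p).toReal) '' S := by
    refine ((hS.image _ hlip.continuousOn).ordConnected).out ⟨p, hp, ?_⟩ ⟨q, hq, rfl⟩
    simp
  refine lt_of_lt_of_le ?_ (measure_mono hsub)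
  rw [Real.volume_Icc, sub_zero]
  exact ENNReal.ofReal_pos.2 hq'

theorem exists_orderIso_hausdorffMeasure_image_Icc {γ : ℝ → X} {K : ℝ≥0} {a b : ℝ} (hab : a < b)
    (hγ : LipschitzOnWith K γ (Icc a b)) (hinj : InjOn γ (Icc a b)) :
    ∃ h : ℝ ≃o ℝ, ∀ s t, a ≤ s → s ≤ t → t ≤ b →
      μH[1] (γ '' Icc s t) = ENNReal.ofReal (h t - h s) := by
  have hsub : ∀ {s t}, a ≤ s → t ≤ b → Icc s t ⊆ Icc a b := fun h h' => Icc_subset_Icc h h'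
  have hle : ∀ s t, a ≤ s → t ≤ b → μH[1] (γ '' Icc s t) ≤ K * ENNReal.ofReal (t - s) := by
    intro s t hs ht
    have := (hγ.mono (hsub hs ht)).hausdorffMeasure_image_le (d := 1) zero_le_one
    rwa [ENNReal.rpow_one, hausdorffMeasure_real, Real.volume_Icc] at this
  have hfin : ∀ s t, a ≤ s → t ≤ b → μH[1] (γ '' Icc s t) ≠ ⊤ := fun s t hs ht =>
    ne_top_of_le_ne_top (ENNReal.mul_ne_top ENNReal.coe_ne_top ENNReal.ofReal_ne_top) (hle s t hs ht)
  have hpos : ∀ s t, a ≤ s → s < t → t ≤ b → 0 < μH[1] (γ '' Icc s t) := by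
    intro s t hs hst ht
    have hs' : s ∈ Icc s t := left_mem_Icc.2 hst.le
    have ht' : t ∈ Icc s t := right_mem_Icc.2 hst.le
    refine hausdorffMeasure_pos_of_isPreconnected
      (isPreconnected_Icc.image _ (hγ.continuousOn.mono (hsub hs ht)))
      (mem_image_of_mem γ hs') (mem_image_of_mem γ ht')
      (fun h => hst.ne (hinj (hsub hs ht hs') (hsub hs ht ht') h)) ?_
    rintro _ ⟨u, hu, rfl⟩
    exact ne_top_of_le_ne_top (ENNReal.mul_ne_top ENNReal.coe_ne_top (edist_ne_top _ _))
      (hγ (hsub hs ht hu) (hsub hs ht hs'))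
  have : NullSingletonClass (μH[1] : Measure X) := Measure.nullSingletonClass_hausdorff X one_pos
  have hadd : ∀ s t, a ≤ s → s ≤ t → t ≤ b →
      μH[1] (γ '' Icc a t) = μH[1] (γ '' Icc a s) + μH[1] (γ '' Icc s t) := by
    intro s t hs hst ht
    rw [← Icc_union_Icc_eq_Icc hs hst, image_union]
    refine measure_union₀ ?_ ?_
    · exact (isCompact_Icc.image_of_continuousOn
        (hγ.continuousOn.mono (hsub hs ht))).isClosed.measurableSet.nullMeasurableSet
    · refine measure_mono_null ?_ (measure_singleton (γ s))
      rw [← hinj.image_inter (hsub le_rfl (hst.trans ht)) (hsub hs ht),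
        Icc_inter_Icc_eq_singleton hs hst, image_singleton]
  let F : ℝ → ℝ := fun t => (μH[1] (γ '' Icc a t)).toReal
  have hF : ∀ s t, a ≤ s → s ≤ t → t ≤ b → F t - F s = (μH[1] (γ '' Icc s t)).toReal := by
    intro s t hs hst ht
    change (μH[1] (γ '' Icc a t)).toReal - _ = _
    rw [hadd s t hs hst ht, ENNReal.toReal_add (hfin _ _ le_rfl (hst.trans ht)) (hfin _ _ hs ht)]
    exact add_sub_cancel_left _ _
  have hFmono : StrictMonoOn F (Icc a b) := by
    intro s hs t ht hst
    rw [← sub_pos, hF s t hs.1 hst.le ht.2]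
    exact ENNReal.toReal_pos (hpos s t hs.1 hst ht.2).ne' (hfin _ _ hs.1 ht.2)
  have hFlip : LipschitzOnWith K F (Icc a b) := by
    have key : ∀ s ∈ Icc a b, ∀ t ∈ Icc a b, s ≤ t → F t - F s ≤ K * (t - s) := by
      intro s hs t ht hst
      rw [hF s t hs.1 hst ht.2]
      refine ENNReal.toReal_le_of_le_ofReal (mul_nonneg K.2 (sub_nonneg.2 hst)) ?_
      rw [ENNReal.ofReal_mul K.coe_nonneg, ENNReal.ofReal_coe_nnreal]
      exact hle s t hs.1 ht.2
    refine LipschitzOnWith.of_le_add_mul K fun s hs t ht => ?_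
    rcases le_total s t with h | h
    · have := hFmono.monotoneOn hs ht h
      have := mul_nonneg K.2 (dist_nonneg (x := s) (y := t))
      linarith!
    · have := key t ht s hs h
      rw [Real.dist_eq, abs_of_nonneg (sub_nonneg.2 h)]
      linarith
  let c : ℝ → ℝ := fun t => max a (min b t)
  have hc : Continuous c := by fun_prop
  have hcmem : ∀ t, c t ∈ Icc a b := fun t => ⟨le_max_left _ _, max_le hab.le (min_le_left _ _)⟩
  have hcid : ∀ t ∈ Icc a b, c t = t := fun t ht => by
    change max a (min b t) = t
    rw [min_eq_right ht.2, max_eq_right ht.1]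
  have hcmono : Monotone c := fun s t h => max_le_max le_rfl (min_le_min le_rfl h)
  have hcsub : ∀ s t, s ≤ t → c t - c s ≤ t - s := by
    intro s t h
    change max a (min b t) - max a (min b s) ≤ t - s
    rcases max_cases a (min b t) with h1 | h1 <;> rcases max_cases a (min b s) with h2 | h2 <;>
      rcases min_cases b t with h3 | h3 <;> rcases min_cases b s with h4 | h4 <;> linarith
  let G : ℝ → ℝ := fun t => F (c t) + (t - c t)
  have hGmono : StrictMono G := by
    intro s t hst
    change F (c s) + (s - c s) < F (c t) + (t - c t)
    have h1 := hcsub s t hst.le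
    rcases (hcmono hst.le).lt_or_eq with h | h
    · have := hFmono (hcmem s) (hcmem t) h
      linarith
    · rw [h]
      linarith
  have hGcont : Continuous G :=
    (hFlip.continuousOn.comp_continuous hc hcmem).add (continuous_id.sub hc)
  have hGsurj : Function.Surjective G := by
    refine hGcont.surjective ?_ ?_
    · refine tendsto_atTop_mono (f := fun t => t - b) (fun t => ?_)
        (tendsto_atTop_add_const_right _ _ tendsto_id)
      have : 0 ≤ F (c t) := ENNReal.toReal_nonneg
      have := (hcmem t).2
      change t - b ≤ F (c t) + (t - c t)
      linarith
    · refine tendsto_atBot_mono (f := fun t => t + (F b - a)) (fun t => ?_)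
        (tendsto_atBot_add_const_right _ _ tendsto_id)
      have := hFmono.monotoneOn (hcmem t) (right_mem_Icc.2 hab.le) (hcmem t).2
      have := (hcmem t).1
      change F (c t) + (t - c t) ≤ t + (F b - a)
      linarith
  refine ⟨hGmono.orderIsoOfSurjective G hGsurj, fun s t hs hst ht => ?_⟩
  change _ = ENNReal.ofReal ((F (c t) + (t - c t)) - (F (c s) + (s - c s)))
  rw [hcid t ⟨hs.trans hst, ht⟩, hcid s ⟨hs, hst.trans ht⟩, sub_self, sub_self, add_zero, add_zero,
    hF s t hs hst ht, ENNReal.ofReal_toReal (hfin s t hs ht)]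

end ArcLength

end MetricFunction

namespace MetricFunction

open Set Filter Topology MeasureTheory
open scoped NNReal ENNReal MeasureTheory

section

variable {X : Type*} [EMetricSpace X]

theorem isIsometricAtlas_setOf_hausdorffMeasure [MeasurableSpace X] [BorelSpace X]
    (h : ∀ x : X, ∃ e : OpenPartialHomeomorph X ℝ, x ∈ e.source ∧
      ∃ K : ℝ≥0, ∃ s ∈ 𝓝 (e x), LipschitzOnWith K e.symm s) :
    IsIsometricAtlas {e : OpenPartialHomeomorph X ℝ | ∀ s t, s ≤ t → Icc s t ⊆ e.target →
      μH[1] (e.symm '' Icc s t) = ENNReal.ofReal (t - s)} := by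
  refine ⟨fun x => ?_, ?_⟩
  · obtain ⟨e, hx, K, s, hs, hK⟩ := h x
    obtain ⟨r, hr, hball⟩ := Metric.nhds_basis_closedBall.mem_iff.1
      (inter_mem hs (e.open_target.mem_nhds (e.map_source hx)))
    rw [Real.closedBall_eq_Icc] at hball
    obtain ⟨φ, hφ⟩ := exists_orderIso_hausdorffMeasure_image_Icc
      (show e x - r < e x + r by linarith) (hK.mono (hball.trans inter_subset_left))
      (e.symm.injOn.mono (hball.trans inter_subset_right))
    refine ⟨(e.trans (OpenPartialHomeomorph.ofSet (Ioo (e x - r) (e x + r)) isOpen_Ioo)).trans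
      φ.toHomeomorph.toOpenPartialHomeomorph, fun s t hst hsub => ?_, ?_⟩
    · have hmem : ∀ u ∈ Icc s t, φ.symm u ∈ Ioo (e x - r) (e x + r) := by
        intro u hu
        have := hsub hu
        simp only [mfld_simps] at this
        exact this.1
      change μH[1] ((fun u => e.symm (φ.symm u)) '' Icc s t) = _
      rw [← image_image e.symm φ.symm, OrderIso.image_Icc,
        hφ _ _ (hmem s (left_mem_Icc.2 hst)).1.le (φ.symm.monotone hst)
          (hmem t (right_mem_Icc.2 hst)).2.le, φ.apply_symm_apply, φ.apply_symm_apply]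
    · simp only [mfld_simps]
      exact ⟨hx, by linarith, by linarith⟩
  · intro e he e' he' x hx hx'
    let T := e.symm.trans e'
    have hT : ∀ t, T t = e' (e.symm t) := fun t => rfl
    have hxT : e x ∈ T.source := by
      simp only [T, mfld_simps, hx, hx']
    obtain ⟨r, hr, hball⟩ := Metric.nhds_basis_closedBall.mem_iff.1 (T.open_source.mem_nhds hxT)
    rw [Real.closedBall_eq_Icc] at hball
    have hc : ContinuousOn T (Icc (e x - r) (e x + r)) := T.continuousOn.mono hball
    have hmem : e x ∈ Icc (e x - r) (e x + r) := ⟨by linarith, by linarith⟩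
    have hmono := hc.strictMonoOn_of_injOn_Icc' (by linarith) (T.injOn.mono hball)
    have himg : ∀ s ∈ Icc (e x - r) (e x + r), ∀ t ∈ Icc (e x - r) (e x + r),
        T '' uIcc s t = uIcc (T s) (T t) := by
      intro s hs t ht
      have hst : uIcc s t ⊆ Icc (e x - r) (e x + r) := ordConnected_Icc.uIcc_subset hs ht
      refine Subset.antisymm ?_ (intermediate_value_uIcc (hc.mono hst))
      rcases hmono with h | h
      · exact (h.monotoneOn.mono hst).image_uIcc_subset
      · exact (h.antitoneOn.mono hst).image_uIcc_subset
    have habs : ∀ s ∈ Icc (e x - r) (e x + r), ∀ t ∈ Icc (e x - r) (e x + r),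
        |T t - T s| = |t - s| := by
      intro s hs t ht
      have hst : uIcc s t ⊆ T.source := (ordConnected_Icc.uIcc_subset hs ht).trans hball
      have h1 := he (min s t) (max s t) min_le_max (fun u hu => (hst hu).1)
      have h2 := he' (min (T s) (T t)) (max (T s) (T t)) min_le_max (by
        change uIcc (T s) (T t) ⊆ _
        rw [← himg s hs t ht]
        rintro _ ⟨u, hu, rfl⟩
        exact e'.map_source (hst hu).2)
      have h3 : e'.symm '' uIcc (T s) (T t) = e.symm '' uIcc s t := by
        rw [← himg s hs t ht, image_image]
        exact image_congr fun u hu => e'.left_inv (hst hu).2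
      rw [max_sub_min_eq_abs'] at h1 h2
      change μH[1] (e.symm '' uIcc s t) = _ at h1
      change μH[1] (e'.symm '' uIcc (T s) (T t)) = _ at h2
      rw [h3, h1, ENNReal.ofReal_eq_ofReal_iff (abs_nonneg _) (abs_nonneg _)] at h2
      rw [abs_sub_comm, ← h2, abs_sub_comm]
    have hnhds : Icc (e x - r) (e x + r) ∈ 𝓝 (e x) := Icc_mem_nhds (by linarith) (by linarith)
    have hTx : T (e x) = e' x := by rw [hT, e.left_inv hx]
    rcases hmono with h | h
    · refine ⟨1, Or.inl rfl, ?_⟩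
      filter_upwards [hnhds] with t ht
      have := habs _ hmem t ht
      rw [← hT, ← hTx]
      rcases le_total (e x) t with h' | h'
      · have h2 := h.monotoneOn hmem ht h'
        rw [abs_of_nonneg (sub_nonneg.2 h2), abs_of_nonneg (sub_nonneg.2 h')] at this
        linarith
      · have h2 := h.monotoneOn ht hmem h'
        rw [abs_of_nonpos (sub_nonpos.2 h2), abs_of_nonpos (sub_nonpos.2 h')] at this
        linarith
    · refine ⟨-1, Or.inr rfl, ?_⟩
      filter_upwards [hnhds] with t ht
      have := habs _ hmem t ht
      rw [← hT, ← hTx]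
      rcases le_total (e x) t with h' | h'
      · have h2 := h.antitoneOn hmem ht h'
        rw [abs_of_nonpos (sub_nonpos.2 h2), abs_of_nonneg (sub_nonneg.2 h')] at this
        linarith
      · have h2 := h.antitoneOn ht hmem h'
        rw [abs_of_nonneg (sub_nonneg.2 h2), abs_of_nonpos (sub_nonpos.2 h')] at this
        linarith

/-- A connected metric space of dimension one, in the sense of charts with locally Lipschitz
inverse, is a circle or a line. -/
theorem nonempty_homeomorph_of_lipschitz_charts [ConnectedSpace X]
    (h : ∀ x : X, ∃ e : OpenPartialHomeomorph X ℝ, x ∈ e.source ∧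
      ∃ K : ℝ≥0, ∃ s ∈ 𝓝 (e x), LipschitzOnWith K e.symm s) :
    Nonempty (X ≃ₜ Circle) ∨ Nonempty (X ≃ₜ ℝ) := by
  borelize X
  exact (isIsometricAtlas_setOf_hausdorffMeasure h).nonempty_homeomorph

end

section

variable {M : Type*} [EMetricSpace M] {f : M → ℝ}

theorem exists_levelSet_chart {p : M} {e : OpenPartialHomeomorph M (ℝ × ℝ)} (hp : p ∈ e.source)
    (he : ∀ x ∈ e.source, (e x).1 = f x) {K : ℝ≥0} {s : Set (ℝ × ℝ)} (hs : s ∈ 𝓝 (e p))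
    (hK : LipschitzOnWith K e.symm s) {c : ℝ} (hc : f p = c) :
    ∃ e' : OpenPartialHomeomorph (f ⁻¹' {c} : Set M) ℝ, (⟨p, hc⟩ : (f ⁻¹' {c} : Set M)) ∈ e'.source ∧
      ∃ s' ∈ 𝓝 (e' ⟨p, hc⟩), LipschitzOnWith K e'.symm s' := by
  classical
  have hfst : ∀ k, (c, k) ∈ e.target → e.symm (c, k) ∈ f ⁻¹' {c} := by
    intro k hk
    have := he _ (e.map_target hk)
    rw [e.right_inv hk] at this
    exact this.symm
  have hpair : ∀ y : (f ⁻¹' {c} : Set M), (y : M) ∈ e.source → (c, (e y).2) = e y := by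
    intro y hy
    exact Prod.ext ((he _ hy).trans y.2).symm rfl
  let inv : ℝ → (f ⁻¹' {c} : Set M) := fun k =>
    if hk : (c, k) ∈ e.target then ⟨e.symm (c, k), hfst k hk⟩ else ⟨p, hc⟩
  have hinv : ∀ k, (c, k) ∈ e.target → (inv k : M) = e.symm (c, k) := by
    intro k hk
    simp only [inv, dif_pos hk]
  have hopen : IsOpen {k : ℝ | (c, k) ∈ e.target} :=
    e.open_target.preimage (by fun_prop : Continuous fun k : ℝ => (c, k))
  let e' : OpenPartialHomeomorph (f ⁻¹' {c} : Set M) ℝ :=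
    { toFun := fun y => (e y).2
      invFun := inv
      source := {y | (y : M) ∈ e.source}
      target := {k | (c, k) ∈ e.target}
      map_source' := fun y hy => by
        rw [mem_ofPred_eq, hpair y hy]
        exact e.map_source hy
      map_target' := fun k hk => by
        rw [mem_ofPred_eq, hinv k hk]
        exact e.map_target hk
      left_inv' := fun y hy => by
        ext
        rw [hinv _ (by rw [hpair y hy]; exact e.map_source hy), hpair y hy, e.left_inv hy]
      right_inv' := fun k hk => by
        rw [hinv k hk, e.right_inv hk]
      open_source := e.open_source.preimage continuous_subtype_val
      open_target := hopen
      continuousOn_toFun := continuous_snd.comp_continuousOn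
        (e.continuousOn.comp continuous_subtype_val.continuousOn fun y hy => hy)
      continuousOn_invFun := by
        rw [IsInducing.subtypeVal.continuousOn_iff]
        refine ContinuousOn.congr (f := fun k => e.symm (c, k)) ?_ hinv
        exact e.symm.continuousOn.comp (by fun_prop) fun k hk => hk }
  have hp' : (c, e' ⟨p, hc⟩) = e p := hpair ⟨p, hc⟩ hp
  refine ⟨e', hp, {k | (c, k) ∈ s ∩ e.target}, ?_, ?_⟩
  · have hcont : ContinuousAt (fun k : ℝ => (c, k)) (e' ⟨p, hc⟩) := by fun_prop
    refine hcont.preimage_mem_nhds ?_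
    rw [hp']
    exact inter_mem hs (e.open_target.mem_nhds (e.map_source hp))
  · intro k hk l hl
    have := hK hk.1 hl.1
    rw [← hinv k hk.2, ← hinv l hl.2] at this
    refine this.trans_eq ?_
    simp [Prod.edist_eq]

end

end MetricFunction

namespace MetricFunction

open Set Topology

theorem nonempty_homeomorph_levelSet_circle_or_real
    {M : Type*} [EMetricSpace M] [ChartedSpace (EuclideanSpace ℝ (Fin 2)) M]
    [Bundle.RiemannianBundle (fun x : M ↦ TangentSpace (𝓡 2) x)]
    [IsManifold (𝓡 2) ∞ M] [IsRiemannianManifold (𝓡 2) M]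
    [IsContMDiffRiemannianBundle (𝓡 2) ∞ (EuclideanSpace ℝ (Fin 2))
      (fun x : M ↦ TangentSpace (𝓡 2) x)]
    {f : M → ℝ} (hf : ContMDiff (𝓡 2) 𝓘(ℝ, ℝ) 2 f)
    (hcrit : ∀ x : M, ¬ IsCriticalPoint (𝓡 2) f x) {c : ℝ} (hc : IsConnected (f ⁻¹' {c})) :
    Nonempty ((f ⁻¹' {c} : Set M) ≃ₜ Circle) ∨ Nonempty ((f ⁻¹' {c} : Set M) ≃ₜ ℝ) := by
  have := isConnected_iff_connectedSpace.1 hc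
  refine nonempty_homeomorph_of_lipschitz_charts fun ⟨p, hp⟩ => ?_
  obtain ⟨e, hpe, he, K, s, hs, hK⟩ := exists_chart_fst_eq_of_isContMDiffRiemannianBundle
    ((hf p).of_le (by norm_num)) (hcrit p)
  obtain ⟨e', hpe', s', hs', hK'⟩ := exists_levelSet_chart hpe he hs hK hp
  exact ⟨e', hpe', K, s', hs', hK'⟩

end MetricFunction

open MetricFunction in
theorem mainTheorem4
    {M : Type*} [EMetricSpace M] [ChartedSpace (EuclideanSpace ℝ (Fin 2)) M]
    [IsManifold (𝓡 2) ∞ M]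
    [Bundle.RiemannianBundle (fun x : M ↦ TangentSpace (𝓡 2) x)]
    [IsContMDiffRiemannianBundle (𝓡 2) ∞ (EuclideanSpace ℝ (Fin 2))
      (fun x : M ↦ TangentSpace (𝓡 2) x)]
    [IsRiemannianManifold (𝓡 2) M]
    [ConnectedSpace M] [CompleteSpace M]
    (f : M → ℝ) (hf : MetricFunction.IsMetricFunction (𝓡 2) f)
    (hcrit : ∀ x : M, ¬ MetricFunction.IsCriticalPoint (𝓡 2) f x) :
    (∀ L ∈ MetricFunction.levelLines f, Nonempty (L ≃ₜ Circle)) ∨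
      (∀ L ∈ MetricFunction.levelLines f, Nonempty (L ≃ₜ ℝ)) := by
  have : IsManifold (𝓡 2) 1 M := .of_le (n := ∞) (by norm_cast)
  obtain ⟨φ, hφ⟩ := exists_isUnitSpeedFlow (contMDiff_unitGrad hf.contMDiff hcrit)
    fun x => norm_unitGrad (hcrit x)
  obtain ⟨x⟩ := ‹ConnectedSpace M›.toNonempty
  have htransfer : ∀ L ∈ levelLines f, Nonempty (L ≃ₜ (f ⁻¹' {f x} : Set M)) := by
    rintro _ ⟨_, ⟨y, rfl⟩, rfl⟩
    exact nonempty_homeomorph_levelSet hf hcrit hφ y x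
  refine (nonempty_homeomorph_levelSet_circle_or_real hf.contMDiff hcrit
    ⟨⟨x, rfl⟩, isPreconnected_levelSet hf hcrit hφ x⟩).imp ?_ ?_
  all_goals
    rintro ⟨ψ⟩ L hL
    exact (htransfer L hL).map fun χ => χ.trans ψ

end
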